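/- Let $\Bbbk$ be a field. An *RSM category* over $\Bbbk$ is a $\Bbbk$-linear rigid symmetric monoidal category $(\mathcal A,\otimes,\mathbf 1)$, with $\otimes$ bilinear on morphisms, such that $\Bbbk\to\operatorname{End}(\mathbf 1)$, $\lambda\mapsto\lambda\,\mathrm{id}_{\mathbf 1}$, is an isomorphism. The *categorical dimension* $\dim X\in\Bbbk$ of an object $X$ is the scalar given by the composite $$\mathbf 1\to X\otimes X^*\xrightarrow{\ \text{braiding}\ }X^*\otimes X\to\mathbf 1$$ of the coevaluation, the braiding and the evaluation. For $n\ge 0$ the symmetric group $S_n$ acts on $X^{\otimes n}$ through the braiding, which gives an algebra morphism $\Bbbk S_n\to\operatorname{End}(X^{\otimes n})$. The $n$-th *skew symmetriser* is $a_n=\sum_{\sigma\in S_n}\operatorname{sgn}(\sigma)\,\sigma\in\Bbbk S_n$; it vanishes on $X$ if its image in $\operatorname{End}(X^{\otimes n})$ is zero. A *tensor ideal* of $\mathcal A$ is a family of subspaces $I(X,Y)\subseteq\operatorname{Hom}(X,Y)$ closed under composition with arbitrary morphisms on both sides and under tensoring with arbitrary objects on both sides; it is *non-zero* if some $I(X,Y)\neq0$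 and *proper* if some $I(X,Y)\neq\operatorname{Hom}(X,Y)$. For $\delta\in\Bbbk$, the *oriented Brauer category* $\mathcal{OB}(\delta)$ is the universal RSM category on an object $V_\delta$ of categorical dimension $\delta$: its objects are the tensor words in $V_\delta$ and $V_\delta^*$, its morphisms are the $\Bbbk$-linear combinations of oriented Brauer diagrams, the tensor product is juxtaposition, and composition is stacking of diagrams, where every closed loop is replaced by the factor $\delta$. 1. Let $X$ be an object of an RSM category over $\Bbbk$ (of any characteristic). If $a_n$ vanishes on $X$ for some $n\ge0$, then there is a largest $m\ge 0$ such that $a_m$ does not vanish on $X$, and $\dim X=m\cdot 1_{\Bbbk}$. 2. Suppose that $\operatorname{char}\Bbbk=p>0$ and $\delta\in\Bbbk$. If $\mathcal{OB}(\delta)$ has a tensor ideal that is non-zero and proper, then $\delta$ lies in the prime field $\mathbb F_p\subseteq\Bbbk$. -/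

import Mathlib

open CategoryTheory MonoidalCategory BraidedCategory

universe v u w

/-! ### The action of the symmetric group on tensor powers -/

section TensorPowers

variable {A : Type u} [Category.{v} A] [MonoidalCategory A]

/-- The tensor power `X ⊗ (X ⊗ (⋯ ⊗ 𝟙))` with `n` factors `X`. -/
abbrev tensorPow (X : A) : ℕ → A
  | 0 => 𝟙_ A
  | n + 1 => X ⊗ tensorPow X n

variable [SymmetricCategory A]

/-- The braiding of the first two tensor factors of `X ⊗ (X ⊗ T)`. -/
def swapHead (X T : A) : X ⊗ (X ⊗ T) ⟶ X ⊗ (X ⊗ T) :=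
  (α_ X X T).inv ≫ (β_ X X).hom ▷ T ≫ (α_ X X T).hom

/-- The braiding of the neighbouring tensor factors `i` and `i + 1` of `X^{⊗ (n + 1)}`. -/
def swapAdj (X : A) : (n : ℕ) → Fin n → (tensorPow X (n + 1) ⟶ tensorPow X (n + 1))
  | _ + 1, ⟨0, _⟩ => swapHead X _
  | n + 1, ⟨i + 1, hi⟩ => X ◁ swapAdj X n ⟨i, Nat.lt_of_succ_lt_succ hi⟩

/-- Move the first tensor factor of `X^{⊗ (n + 1)}` to position `p`, past `p` other factors. -/
def moveHead (X : A) : (n : ℕ) → Fin (n + 1) → (tensorPow X (n + 1) ⟶ tensorPow X (n + 1))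
  | _, ⟨0, _⟩ => 𝟙 _
  | n + 1, ⟨p + 1, hp⟩ =>
      swapHead X _ ≫ X ◁ moveHead X n ⟨p, Nat.lt_of_succ_lt_succ hp⟩

/-- The permutation of `Fin n` induced by `σ` on the complements of `0` and of `σ 0`, both
identified with `Fin n` in the order preserving way. -/
def permTail {n : ℕ} (σ : Equiv.Perm (Fin (n + 1))) : Equiv.Perm (Fin n) :=
  Equiv.removeNone (((finSuccEquiv n).symm.trans σ).trans (finSuccEquiv' (σ 0)))

theorem succAbove_permTail {n : ℕ} (σ : Equiv.Perm (Fin (n + 1))) (j : Fin n) :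
    (σ 0).succAbove (permTail σ j) = σ j.succ := by
  have h : ∃ x', (((finSuccEquiv n).symm.trans σ).trans (finSuccEquiv' (σ 0))) (some j)
      = some x' := by
    rw [← Option.ne_none_iff_exists']
    intro h
    simp only [Equiv.trans_apply, finSuccEquiv_symm_some] at h
    rw [← finSuccEquiv'_at (σ 0), (finSuccEquiv' (σ 0)).injective.eq_iff, σ.injective.eq_iff] at h
    exact Fin.succ_ne_zero j h
  have := Equiv.removeNone_some _ h
  change some (permTail σ j) = _ at this
  have h2 := congrArg (finSuccEquiv' (σ 0)).symm this
  simpa using h2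

/-- The morphism `X^{⊗ n} ⟶ X^{⊗ n}` by which `σ` permutes the tensor factors: permute the last
`n` factors by `permTail σ`, then move the first factor to position `σ 0`. -/
def permHom (X : A) : (n : ℕ) → Equiv.Perm (Fin n) → (tensorPow X n ⟶ tensorPow X n)
  | 0, _ => 𝟙 _
  | n + 1, σ => X ◁ permHom X n (permTail σ) ≫ moveHead X n (σ 0)

theorem swapHead_swapHead (X T : A) : swapHead X T ≫ swapHead X T = 𝟙 _ := by
  simp [swapHead, ← comp_whiskerRight_assoc]

theorem swapHead_naturality (X : A) {T T' : A} (f : T ⟶ T') :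
    X ◁ X ◁ f ≫ swapHead X T' = swapHead X T ≫ X ◁ X ◁ f := by
  simp only [swapHead, associator_inv_naturality_right_assoc, Category.assoc,
    whisker_exchange_assoc, associator_naturality_right]

theorem swapHead_yangBaxter (X T : A) :
    swapHead X (X ⊗ T) ≫ X ◁ swapHead X T ≫ swapHead X (X ⊗ T) =
      X ◁ swapHead X T ≫ swapHead X (X ⊗ T) ≫ X ◁ swapHead X T := by
  have h := congrArg (fun f => (α_ X X (X ⊗ T)).inv ≫ (α_ (X ⊗ X) X T).inv ≫ (α_ X X X).hom ▷ T ≫ f ▷ T ≫ (α_ X (X ⊗ X) T).hom ≫ X ◁ (α_ X X T).hom) (yang_baxter X X X)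
  simp only [swapHead]
  convert h using 1 
  · simp
  · simp



theorem swapAdj_zero (X : A) (n : ℕ) (h : 0 < n + 1) :
    swapAdj X (n + 1) ⟨0, h⟩ = swapHead X (tensorPow X n) := rfl

theorem swapAdj_succ (X : A) (n i : ℕ) (h : i + 1 < n + 1) :
    swapAdj X (n + 1) ⟨i + 1, h⟩ = X ◁ swapAdj X n ⟨i, Nat.lt_of_succ_lt_succ h⟩ := rfl

theorem moveHead_zero (X : A) (n : ℕ) (h : 0 < n + 1) :
    moveHead X n ⟨0, h⟩ = 𝟙 (X ⊗ tensorPow X n) := by cases n <;> rfl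

theorem moveHead_succ (X : A) (n p : ℕ) (h : p + 1 < n + 2) :
    moveHead X (n + 1) ⟨p + 1, h⟩ = swapHead X (tensorPow X n) ≫
      X ◁ moveHead X n ⟨p, Nat.lt_of_succ_lt_succ h⟩ := rfl

theorem moveHead_swapAdj (X : A) : ∀ (n i : ℕ) (h : i < n),
    moveHead X n ⟨i, by omega⟩ ≫ swapAdj X n ⟨i, h⟩ = moveHead X n ⟨i + 1, by omega⟩
  | n + 1, 0, _ => by
      rw [moveHead_zero, swapAdj_zero, moveHead_succ, moveHead_zero]
      simp
  | n + 1, i + 1, hi => by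
      rw [moveHead_succ, swapAdj_succ, moveHead_succ, Category.assoc, ← whiskerLeft_comp,
        moveHead_swapAdj X n i]

theorem swapAdj_swapAdj (X : A) : ∀ (n i : ℕ) (h : i < n),
    swapAdj X n ⟨i, h⟩ ≫ swapAdj X n ⟨i, h⟩ = 𝟙 (X ⊗ tensorPow X n)
  | n + 1, 0, _ => swapHead_swapHead X _
  | n + 1, i + 1, hi => by
      rw [swapAdj_succ, ← whiskerLeft_comp, swapAdj_swapAdj X n i, whiskerLeft_id]

theorem moveHead_swapAdj_lt (X : A) : ∀ (n i p : ℕ) (hi : i < n) (hp : p < n + 2)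
    (_ : i + 1 < p),
    X ◁ swapAdj X n ⟨i, hi⟩ ≫ moveHead X (n + 1) ⟨p, hp⟩ =
      moveHead X (n + 1) ⟨p, hp⟩ ≫ swapAdj X (n + 1) ⟨i, by omega⟩
  | n + 1, 0, p + 2, _, hp, _ => by
      rw [swapAdj_zero, swapAdj_zero, moveHead_succ, moveHead_succ, whiskerLeft_comp]
      simp only [Category.assoc]
      rw [swapHead_naturality, reassoc_of% swapHead_yangBaxter X (tensorPow X n)]
  | n + 1, i + 1, p + 1, hi, hp, h => by
      rw [swapAdj_succ, swapAdj_succ, moveHead_succ, reassoc_of% swapHead_naturality,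
        ← whiskerLeft_comp, moveHead_swapAdj_lt X n i p (by omega) (by omega) (by omega),
        whiskerLeft_comp, Category.assoc]

theorem moveHead_swapAdj_gt (X : A) : ∀ (n i p : ℕ) (hi : i < n) (hp : p < n + 2)
    (_ : p ≤ i),
    X ◁ swapAdj X n ⟨i, hi⟩ ≫ moveHead X (n + 1) ⟨p, hp⟩ =
      moveHead X (n + 1) ⟨p, hp⟩ ≫ swapAdj X (n + 1) ⟨i + 1, by omega⟩
  | n + 1, i, 0, hi, hp, _ => by
      rw [moveHead_zero, swapAdj_succ, Category.id_comp, Category.comp_id]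
  | n + 1, i + 1, p + 1, hi, hp, h => by
      rw [swapAdj_succ, swapAdj_succ, moveHead_succ, reassoc_of% swapHead_naturality,
        ← whiskerLeft_comp, moveHead_swapAdj_gt X n i p (by omega) (by omega) (by omega),
        whiskerLeft_comp, Category.assoc]

theorem permTail_eq {n : ℕ} (σ : Equiv.Perm (Fin (n + 1))) (τ : Equiv.Perm (Fin n))
    (h : ∀ j, (σ 0).succAbove (τ j) = σ j.succ) : permTail σ = τ := by
  ext j
  have := (succAbove_permTail σ j).trans (h j).symm
  rw [Fin.succAbove_right_injective this]

theorem permHom_succ (X : A) (n : ℕ) (σ : Equiv.Perm (Fin (n + 1))) :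
    permHom X (n + 1) σ = X ◁ permHom X n (permTail σ) ≫ moveHead X n (σ 0) := rfl

theorem permHom_one (X : A) : ∀ n, permHom X n 1 = 𝟙 (tensorPow X n)
  | 0 => rfl
  | n + 1 => by
      have h : permTail (1 : Equiv.Perm (Fin (n + 1))) = 1 := permTail_eq _ _ (by simp)
      have h0 : moveHead X n ((1 : Equiv.Perm (Fin (n + 1))) 0) = 𝟙 _ := moveHead_zero X n _
      rw [permHom, h, permHom_one X n, h0]
      simp

/-- The transposition of the neighbours `i` and `i + 1`. -/
def adjSwap {n : ℕ} (i : Fin n) : Equiv.Perm (Fin (n + 1)) := Equiv.swap i.castSucc i.succ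

theorem permHom_adjSwap_mul (X : A) : ∀ (n : ℕ) (i : Fin n) (σ : Equiv.Perm (Fin (n + 1))),
    permHom X (n + 1) (adjSwap i * σ) = permHom X (n + 1) σ ≫ swapAdj X n i
  | n + 1, ⟨i, hi⟩, σ => by
      obtain ⟨p, hp⟩ : ∃ p, p = σ 0 := ⟨_, rfl⟩
      obtain ⟨p, hpn⟩ := p
      have hs : ∀ j, σ j.succ = (⟨p, hpn⟩ : Fin (n + 2)).succAbove (permTail σ j) := by
        intro j; rw [hp, succAbove_permTail]
      rw [permHom_succ X (n + 1), permHom_succ X (n + 1), ← hp]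
      by_cases h1 : p = i
      · subst h1
        have h0 : (adjSwap (⟨p, hi⟩ : Fin (n + 1)) * σ) 0 = ⟨p + 1, by omega⟩ := by
          simp [adjSwap, ← hp]
        have ht : permTail (adjSwap (⟨p, hi⟩ : Fin (n + 1)) * σ) = permTail σ := by
          apply permTail_eq
          intro j
          rw [h0, Equiv.Perm.mul_apply, hs]
          generalize permTail σ j = q
          obtain ⟨q, hq⟩ := q
          clear hs hp h0
          ext
          simp only [adjSwap, Equiv.swap_apply_def, Fin.succAbove, Fin.lt_def, Fin.ext_iff,
            Fin.castSucc_mk, Fin.succ_mk]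
          split_ifs <;> simp_all <;> omega
        rw [h0, ht, Category.assoc, moveHead_swapAdj]
      by_cases h2 : p = i + 1
      · subst h2
        have h0 : (adjSwap (⟨i, hi⟩ : Fin (n + 1)) * σ) 0 = ⟨i, by omega⟩ := by
          simp [adjSwap, ← hp]
        have ht : permTail (adjSwap (⟨i, hi⟩ : Fin (n + 1)) * σ) = permTail σ := by
          apply permTail_eq
          intro j
          rw [h0, Equiv.Perm.mul_apply, hs]
          generalize permTail σ j = q
          obtain ⟨q, hq⟩ := q
          clear hs hp h0
          ext
          simp only [adjSwap, Equiv.swap_apply_def, Fin.succAbove, Fin.lt_def, Fin.ext_iff,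
            Fin.castSucc_mk, Fin.succ_mk]
          split_ifs <;> simp_all <;> omega
        rw [h0, ht, Category.assoc, ← moveHead_swapAdj X (n + 1) i hi, Category.assoc,
          swapAdj_swapAdj, Category.comp_id]
      have h0 : (adjSwap (⟨i, hi⟩ : Fin (n + 1)) * σ) 0 = ⟨p, hpn⟩ := by
        rw [Equiv.Perm.mul_apply, ← hp]
        apply Equiv.swap_apply_of_ne_of_ne <;> simp [Fin.ext_iff, h1, h2]
      by_cases h3 : i + 1 < p
      · have ht : permTail (adjSwap (⟨i, hi⟩ : Fin (n + 1)) * σ) =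
            adjSwap (⟨i, by omega⟩ : Fin n) * permTail σ := by
          apply permTail_eq
          intro j
          rw [h0, Equiv.Perm.mul_apply, Equiv.Perm.mul_apply, hs]
          generalize permTail σ j = q
          obtain ⟨q, hq⟩ := q
          clear hs hp h0
          ext
          simp only [adjSwap, Equiv.swap_apply_def, Fin.succAbove, Fin.lt_def, Fin.ext_iff,
            Fin.castSucc_mk, Fin.succ_mk]
          split_ifs <;> simp_all <;> omega
        rw [h0, ht, permHom_adjSwap_mul X n, whiskerLeft_comp, Category.assoc,
          moveHead_swapAdj_lt X n i p (by omega) hpn h3, Category.assoc]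
      · obtain ⟨i, rfl⟩ : ∃ i', i = i' + 1 := ⟨i - 1, by omega⟩
        have ht : permTail (adjSwap (⟨i + 1, hi⟩ : Fin (n + 1)) * σ) =
            adjSwap (⟨i, by omega⟩ : Fin n) * permTail σ := by
          apply permTail_eq
          intro j
          rw [h0, Equiv.Perm.mul_apply, Equiv.Perm.mul_apply, hs]
          generalize permTail σ j = q
          obtain ⟨q, hq⟩ := q
          clear hs hp h0
          ext
          simp only [adjSwap, Equiv.swap_apply_def, Fin.succAbove, Fin.lt_def, Fin.ext_iff,
            Fin.castSucc_mk, Fin.succ_mk]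
          split_ifs <;> first | omega | (dsimp only at *; omega) | (simp at * <;> omega)
        rw [h0, ht, permHom_adjSwap_mul X n, whiskerLeft_comp, Category.assoc,
          moveHead_swapAdj_gt X n i p (by omega) hpn (by omega), Category.assoc]

theorem permHom_mul (X : A) : ∀ (n : ℕ) (τ σ : Equiv.Perm (Fin n)),
    permHom X n (τ * σ) = permHom X n σ ≫ permHom X n τ
  | 0, τ, σ => by simp [permHom]
  | n + 1, τ, σ => by
      have hτ : τ ∈ Submonoid.closure
          (Set.range fun i : Fin n => Equiv.swap i.castSucc i.succ) := by
        rw [Equiv.Perm.mclosure_swap_castSucc_succ]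
        trivial
      induction hτ using Submonoid.closure_induction generalizing σ with
      | mem x hx =>
          obtain ⟨i, rfl⟩ := hx
          have h1 := permHom_adjSwap_mul X n i 1
          rw [mul_one, permHom_one, Category.id_comp] at h1
          exact (permHom_adjSwap_mul X n i σ).trans (by rw [← h1]; rfl)
      | one => rw [one_mul, permHom_one, Category.comp_id]
      | mul x y _ _ hx hy => rw [mul_assoc, hx, hy, hx y, Category.assoc]

/-- The action of the symmetric group on `X^{⊗ n}` through the symmetric braiding. -/
def permAction (X : A) (n : ℕ) : Equiv.Perm (Fin n) →* End (tensorPow X n) where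
  toFun := permHom X n
  map_one' := permHom_one X n
  map_mul' := permHom_mul X n

/-- The transposition of `i` and `i + 1` acts by the braiding of these two tensor factors. -/
theorem permAction_swap (X : A) (n : ℕ) (i : Fin n) :
    permAction X (n + 1) (Equiv.swap i.castSucc i.succ) = swapAdj X n i := by
  have h1 := permHom_adjSwap_mul X n i 1
  rw [mul_one, permHom_one, Category.id_comp] at h1
  exact h1

end TensorPowers

section RSMCategories

variable (k : Type w) [Field k]

/-- The skew symmetriser `∑ σ, sign(σ) σ` in the group algebra `k S_n`. -/
noncomputable def skewSymmetriser (n : ℕ) : MonoidAlgebra k (Equiv.Perm (Fin n)) :=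
  ∑ σ : Equiv.Perm (Fin n), MonoidAlgebra.single σ ((Equiv.Perm.sign σ : ℤ) : k)

variable {A : Type u} [Category.{v} A] [Preadditive A] [Linear k A] [MonoidalCategory A]

/-- The braiding morphism `k S_n → End(X^{⊗ n})`. -/
noncomputable def braidingMorphism [SymmetricCategory A] (X : A) (n : ℕ) :
    MonoidAlgebra k (Equiv.Perm (Fin n)) →ₐ[k] End (tensorPow X n) :=
  MonoidAlgebra.lift k (End (tensorPow X n)) (Equiv.Perm (Fin n)) (permAction X n)

variable (A) in
/-- A `k`-linear rigid symmetric monoidal category is an RSM category if the canonical morphism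
`k → End(𝟙)` is an isomorphism. -/
class IsRSMCategory [SymmetricCategory A] [MonoidalPreadditive A] [MonoidalLinear k A]
    [RigidCategory A] : Prop where
  bijective_algebraMap : Function.Bijective (algebraMap k (End (𝟙_ A)))

/-- The trace of the identity of `X`: coevaluation, braiding, evaluation. -/
def dimEnd [SymmetricCategory A] [RigidCategory A] (X : A) : End (𝟙_ A) :=
  η_ X Xᘁ ≫ (β_ X Xᘁ).hom ≫ ε_ X Xᘁ

/-- The categorical dimension of `X`, as an element of `k ≅ End(𝟙)`. -/
noncomputable def categoricalDim [SymmetricCategory A] [MonoidalPreadditive A]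
    [MonoidalLinear k A] [RigidCategory A] [IsRSMCategory k A] (X : A) : k :=
  (Equiv.ofBijective _ (IsRSMCategory.bijective_algebraMap (k := k) (A := A))).symm (dimEnd X)

variable (A) in
/-- A (two-sided) tensor ideal: subspaces of all morphism spaces, stable under composition with
arbitrary morphisms and under the tensor product with arbitrary objects on either side. -/
structure TensorIdeal where
  mor : ∀ X Y : A, Submodule k (X ⟶ Y)
  comp_mem : ∀ {X Y Z : A} (f : X ⟶ Y) (g : Y ⟶ Z), f ∈ mor X Y → f ≫ g ∈ mor X Z
  precomp_mem : ∀ {X Y Z : A} (f : X ⟶ Y) (g : Y ⟶ Z), g ∈ mor Y Z → f ≫ g ∈ mor X Z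
  whiskerLeft_mem : ∀ (Z : A) {X Y : A} (f : X ⟶ Y), f ∈ mor X Y → Z ◁ f ∈ mor (Z ⊗ X) (Z ⊗ Y)
  whiskerRight_mem : ∀ {X Y : A} (f : X ⟶ Y) (Z : A), f ∈ mor X Y → f ▷ Z ∈ mor (X ⊗ Z) (Y ⊗ Z)

variable {k} in
/-- The ideal contains a non-zero morphism. -/
def TensorIdeal.IsNonzero (I : TensorIdeal k A) : Prop :=
  ∃ (X Y : A) (f : X ⟶ Y), f ∈ I.mor X Y ∧ f ≠ 0

variable {k} in
/-- The ideal does not contain all morphisms. -/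
def TensorIdeal.IsProper (I : TensorIdeal k A) : Prop :=
  ∃ (X Y : A) (f : X ⟶ Y), f ∉ I.mor X Y

end RSMCategories

/-! ### The oriented Brauer category

Objects are the bracketed words in `V` and its dual. Morphisms are linear combinations of oriented
Brauer diagrams; diagrams are composed by stacking them and replacing each closed loop by `δ`. -/

/-- The (bracketed) tensor words in the letters `gen`, which stands for `V_δ`, and `dual`, which
stands for its dual. The empty word is `one`. -/
inductive OBWord : Type
  | one : OBWord
  | gen : OBWord
  | dual : OBWord
  | tensor : OBWord → OBWord → OBWord

namespace OBWord

/-- The set of occurrences of the letter `gen` (upward points) in a word. -/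
def Up : OBWord → Type
  | one => Empty
  | gen => Unit
  | dual => Empty
  | tensor X Y => Up X ⊕ Up Y

/-- The set of occurrences of the letter `dual` (downward points) in a word. -/
def Dn : OBWord → Type
  | one => Empty
  | gen => Empty
  | dual => Unit
  | tensor X Y => Dn X ⊕ Dn Y

theorem finite_up : ∀ X : OBWord, Finite (Up X)
  | one => inferInstanceAs (Finite Empty)
  | gen => inferInstanceAs (Finite Unit)
  | dual => inferInstanceAs (Finite Empty)
  | tensor X Y => by
      have := finite_up X
      have := finite_up Y
      exact inferInstanceAs (Finite (Up X ⊕ Up Y))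

theorem finite_dn : ∀ X : OBWord, Finite (Dn X)
  | one => inferInstanceAs (Finite Empty)
  | gen => inferInstanceAs (Finite Empty)
  | dual => inferInstanceAs (Finite Unit)
  | tensor X Y => by
      have := finite_dn X
      have := finite_dn Y
      exact inferInstanceAs (Finite (Dn X ⊕ Dn Y))

instance (X : OBWord) : Finite (Up X) := finite_up X
instance (X : OBWord) : Finite (Dn X) := finite_dn X

def upAssoc (X Y Z : OBWord) : Up ((X.tensor Y).tensor Z) ≃ Up (X.tensor (Y.tensor Z)) :=
  Equiv.sumAssoc (Up X) (Up Y) (Up Z)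

def upOneTensor (X : OBWord) : Up (one.tensor X) ≃ Up X := Equiv.emptySum Empty (Up X)

def upTensorOne (X : OBWord) : Up (X.tensor one) ≃ Up X := Equiv.sumEmpty (Up X) Empty

def upComm (X Y : OBWord) : Up (X.tensor Y) ≃ Up (Y.tensor X) := Equiv.sumComm (Up X) (Up Y)

def upCongr {X X' Y Y' : OBWord} (e : Up X ≃ Up Y) (e' : Up X' ≃ Up Y') :
    Up (X.tensor X') ≃ Up (Y.tensor Y') := Equiv.sumCongr e e'

def dnAssoc (X Y Z : OBWord) : Dn ((X.tensor Y).tensor Z) ≃ Dn (X.tensor (Y.tensor Z)) :=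
  Equiv.sumAssoc (Dn X) (Dn Y) (Dn Z)

def dnOneTensor (X : OBWord) : Dn (one.tensor X) ≃ Dn X := Equiv.emptySum Empty (Dn X)

def dnTensorOne (X : OBWord) : Dn (X.tensor one) ≃ Dn X := Equiv.sumEmpty (Dn X) Empty

def dnComm (X Y : OBWord) : Dn (X.tensor Y) ≃ Dn (Y.tensor X) := Equiv.sumComm (Dn X) (Dn Y)

def dnCongr {X X' Y Y' : OBWord} (e : Dn X ≃ Dn Y) (e' : Dn X' ≃ Dn Y') :
    Dn (X.tensor X') ≃ Dn (Y.tensor Y') := Equiv.sumCongr e e'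

theorem upCongr_refl (X Y : OBWord) :
    upCongr (Equiv.refl (Up X)) (Equiv.refl (Up Y)) = Equiv.refl _ := Equiv.sumCongr_refl

theorem dnCongr_refl (X Y : OBWord) :
    dnCongr (Equiv.refl (Dn X)) (Equiv.refl (Dn Y)) = Equiv.refl _ := Equiv.sumCongr_refl

end OBWord

open OBWord

/-- Oriented Brauer diagrams from the word `X` (at the bottom) to the word `Y` (at the top), without
closed loops: oriented matchings of the letters. A strand starts at an upward point of `X` or a
downward point of `Y`, and ends at an upward point of `Y` or a downward point of `X`. -/
abbrev OBDiagram (X Y : OBWord) : Type := Up X ⊕ Dn Y ≃ Up Y ⊕ Dn X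

namespace OBDiagram

variable {X Y Z W X' Y' Z' : OBWord}

/-- The points of three words. -/
abbrev GluePt (X Y Z : OBWord) : Type := (Up X ⊕ Dn X) ⊕ (Up Y ⊕ Dn Y) ⊕ (Up Z ⊕ Dn Z)

/-- Stack `g` on top of `f`: two points are linked if they are the start and the end of a strand of
`f` or of a strand of `g`. -/
inductive Strand (f : OBDiagram X Y) (g : OBDiagram Y Z) : GluePt X Y Z → GluePt X Y Z → Prop
  | bot (s : Up X ⊕ Dn Y) : Strand f g
      (s.elim (fun x => .inl (.inl x)) (fun y => .inr (.inl (.inr y))))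
      ((f s).elim (fun y => .inr (.inl (.inl y))) (fun x => .inl (.inr x)))
  | top (s : Up Y ⊕ Dn Z) : Strand f g
      (s.elim (fun y => .inr (.inl (.inl y))) (fun z => .inr (.inr (.inr z))))
      ((g s).elim (fun z => .inr (.inr (.inl z))) (fun y => .inr (.inl (.inr y))))

/-- The connected components of the stacked picture. -/
abbrev Component (f : OBDiagram X Y) (g : OBDiagram Y Z) : Type := Quot (Strand f g)

/-- The number of closed loops: components which meet neither the bottom word `X` nor the top word
`Z`. -/
noncomputable def loops (f : OBDiagram X Y) (g : OBDiagram Y Z) : ℕ :=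
  Nat.card {c : Component f g //
    (∀ x, Quot.mk _ (.inl x) ≠ c) ∧ (∀ z, Quot.mk _ (.inr (.inr z)) ≠ c)}

/-- The component of a point at which a strand of the composite has to start. -/
def startComponent (f : OBDiagram X Y) (g : OBDiagram Y Z) (s : Up X ⊕ Dn Z) : Component f g :=
  Quot.mk _ (s.elim (fun x => .inl (.inl x)) (fun z => .inr (.inr (.inr z))))

/-- The component of a point at which a strand of the composite has to end. -/
def endComponent (f : OBDiagram X Y) (g : OBDiagram Y Z) (t : Up Z ⊕ Dn X) : Component f g :=
  Quot.mk _ (t.elim (fun z => .inr (.inr (.inl z))) (fun x => .inl (.inr x)))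

/-- Colourings which are preserved by a bijection. -/
def TraceCompat {A B U C : Type} (φ : A ⊕ U ≃ B ⊕ U) (c : A → C) (d : B → C) (u : U → C) : Prop :=
  ∀ s, Sum.elim c u s = Sum.elim d u (φ s)

theorem option_compat {S T C : Type} (φ : Option S ≃ Option T) (a : S → C) (b : T → C) (x : C) :
    (∀ s : Option S, s.elim x a = (φ s).elim x b) ↔
      (∀ t, φ none = some t → x = b t) ∧ ∀ s, a s = b (φ.removeNone s) := by
  constructor
  · intro h
    have h0 : ∀ t, φ none = some t → x = b t := by
      intro t ht
      have := h none
      simpa [ht] using this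
    refine ⟨h0, fun s => ?_⟩
    rcases hs : φ (some s) with _ | t
    · have h1 := Equiv.removeNone_none φ hs
      have h2 := h (some s)
      rw [hs] at h2
      simp only [Option.elim_some, Option.elim_none] at h2
      rw [h2]
      exact h0 _ h1.symm
    · have h1 := Equiv.removeNone_some φ ⟨t, hs⟩
      have h2 := h (some s)
      rw [← h1] at h2
      simpa using h2
  · rintro ⟨h0, h⟩ (_ | s)
    · rcases hs : φ none with _ | t
      · rfl
      · simpa using h0 t hs
    · rcases hs : φ (some s) with _ | t
      · have h1 := Equiv.removeNone_none φ hs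
        simp only [Option.elim_some, Option.elim_none]
        rw [h, h0 _ h1.symm]
      · have h1 := Equiv.removeNone_some φ ⟨t, hs⟩
        rw [← Option.some.inj (h1.trans hs)]
        exact h s

open Classical in
theorem exists_trace (U : Type) [Finite U] : ∀ (A B : Type) (φ : A ⊕ U ≃ B ⊕ U),
    ∃ (ψ : A ≃ B) (l : ℕ), ∀ (C : Type) [Finite C] (c : A → C) (d : B → C),
      Nat.card {u : U → C // TraceCompat φ c d u} =
        if (∀ a, c a = d (ψ a)) then Nat.card C ^ l else 0 := by
  induction U using Finite.induction_empty_option with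
  | of_equiv e ih =>
      intro A B φ
      obtain ⟨ψ, l, h⟩ := ih A B (((Equiv.refl A).sumCongr e).trans
        (φ.trans ((Equiv.refl B).sumCongr e.symm)))
      refine ⟨ψ, l, fun C _ c d => ?_⟩
      rw [← h C c d]
      refine Nat.card_congr ((Equiv.arrowCongr e.symm (Equiv.refl C)).subtypeEquiv fun u => ?_)
      unfold TraceCompat
      rw [← ((Equiv.refl A).sumCongr e).forall_congr_right]
      refine forall_congr' fun s => ?_
      have h1 : Sum.elim c u (((Equiv.refl A).sumCongr e) s) =
        Sum.elim c (((e.symm).arrowCongr (Equiv.refl C)) u) s := by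
        rcases s with a | a <;> simp [Equiv.arrowCongr]
      rw [h1]
      simp only [Equiv.trans_apply]
      generalize φ _ = t
      have h2 : Sum.elim d u t =
        Sum.elim d (((e.symm).arrowCongr (Equiv.refl C)) u)
          (((Equiv.refl B).sumCongr e.symm) t) := by
        rcases t with a | a <;> simp [Equiv.arrowCongr]
      rw [h2]
  | h_empty =>
      intro A B φ
      refine ⟨(Equiv.sumEmpty A PEmpty).symm.trans (φ.trans (Equiv.sumEmpty B PEmpty)), 0,
        fun C _ c d => ?_⟩
      have h1 : ∀ u : PEmpty → C, TraceCompat φ c d u ↔ 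
        (∀ a, c a = d (((Equiv.sumEmpty A PEmpty).symm.trans (φ.trans (Equiv.sumEmpty B PEmpty))) a)) := by
        intro u
        unfold TraceCompat
        simp only [Sum.forall, IsEmpty.forall_iff, and_true, Equiv.trans_apply, Sum.elim_inl]
        refine forall_congr' fun a => ?_
        have : (Equiv.sumEmpty A PEmpty).symm a = Sum.inl a := rfl
        rw [this]
        rcases φ (Sum.inl a) with b | b
        · simp
        · exact b.elim
      split_ifs with h2
      · have : Unique {u : PEmpty → C // TraceCompat φ c d u} :=
          ⟨⟨⟨PEmpty.elim, (h1 _).2 h2⟩⟩, fun u => Subtype.ext (funext fun x => x.elim)⟩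
        simp
      · have : IsEmpty {u : PEmpty → C // TraceCompat φ c d u} := ⟨fun u => h2 ((h1 _).1 u.2)⟩
        simp
  | h_option ih =>
      rename_i U _
      intro A B φ
      let eA : ∀ A : Type, A ⊕ Option U ≃ Option (A ⊕ U) := fun A =>
        ((Equiv.refl A).sumCongr (Equiv.optionEquivSumPUnit.{0} U)).trans
          ((Equiv.sumAssoc A U PUnit).symm.trans (Equiv.optionEquivSumPUnit.{0} (A ⊕ U)).symm)
      have heA : ∀ (A C : Type) (c : A → C) (u : Option U → C) (s : A ⊕ Option U),
          Sum.elim c u s = (eA A s).elim (u none) (Sum.elim c (fun x => u (some x))) := by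
        intro A C c u s
        rcases s with a | _ | x <;> rfl
      let φ' : Option (A ⊕ U) ≃ Option (B ⊕ U) := (eA A).symm.trans (φ.trans (eA B))
      obtain ⟨ψ, l, h⟩ := ih A B φ'.removeNone
      have key : ∀ (C : Type) (c : A → C) (d : B → C) (u : Option U → C),
          TraceCompat φ c d u ↔ 
            (∀ t, φ' none = some t → u none = Sum.elim d (fun x => u (some x)) t) ∧
            TraceCompat φ'.removeNone c d (fun x => u (some x)) := by
        intro C c d u
        unfold TraceCompat
        rw [← option_compat φ', ← (eA A).forall_congr_right]
        refine forall_congr' fun s => ?_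
        rw [heA, heA]
        simp [φ']
      rcases hn : φ' none with _ | t
      · refine ⟨ψ, l + 1, fun C _ c d => ?_⟩
        have e : {u : Option U → C // TraceCompat φ c d u} ≃
            C × {u : U → C // TraceCompat φ'.removeNone c d u} :=
          { toFun := fun u => ⟨u.1 none, fun x => u.1 (some x), ((key C c d u.1).1 u.2).2⟩
            invFun := fun p => ⟨fun o => o.elim p.1 p.2.1, (key C c d _).2 ⟨by simp [hn], p.2.2⟩⟩
            left_inv := by rintro ⟨u, hu⟩; ext (_ | x) <;> rfl
            right_inv := by rintro ⟨x, u, hu⟩; rfl }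
        rw [Nat.card_congr e, Nat.card_prod, h C c d]
        split_ifs
        · ring
        · ring
      · refine ⟨ψ, l, fun C _ c d => ?_⟩
        have e : {u : Option U → C // TraceCompat φ c d u} ≃
            {u : U → C // TraceCompat φ'.removeNone c d u} :=
          { toFun := fun u => ⟨fun x => u.1 (some x), ((key C c d u.1).1 u.2).2⟩
            invFun := fun p => ⟨fun o => o.elim (Sum.elim d p.1 t) p.1,
              (key C c d _).2 ⟨by
                intro t' ht'
                rw [hn, Option.some_inj] at ht'
                subst ht'
                rfl, p.2⟩⟩
            left_inv := by
              rintro ⟨u, hu⟩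
              ext (_ | x)
              · exact (((key C c d u).1 hu).1 t hn).symm
              · rfl
            right_inv := by rintro ⟨u, hu⟩; rfl }
        rw [Nat.card_congr e, h C c d]


/-- Colourings of the letters of a word. -/
abbrev Col (C : Type) (X : OBWord) : Type := (Up X → C) × (Dn X → C)

/-- Both ends of each strand have the same colour. -/
def Compat {C : Type} (f : OBDiagram X Y) (c : Col C X) (d : Col C Y) : Prop :=
  ∀ s, Sum.elim c.1 d.2 s = Sum.elim d.1 c.2 (f s)

def shuffle (P Q R S : Type) : (P ⊕ S) ⊕ (Q ⊕ R) ≃ (P ⊕ R) ⊕ (Q ⊕ S) :=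
  ((Equiv.refl _).sumCongr (Equiv.sumComm Q R)).trans
    ((Equiv.sumSumSumComm P S R Q).trans ((Equiv.refl _).sumCongr (Equiv.sumComm S Q)))

open Classical in
theorem exists_glue (f : OBDiagram X Y) (g : OBDiagram Y Z) :
    ∃ (h : OBDiagram X Z) (l : ℕ), ∀ (C : Type) [Finite C] (c : Col C X) (e : Col C Z),
      Nat.card {d : Col C Y // Compat f c d ∧ Compat g d e} =
        if Compat h c e then Nat.card C ^ l else 0 := by
  obtain ⟨h, l, H⟩ := exists_trace (Up Y ⊕ Dn Y) (Up X ⊕ Dn Z) (Up Z ⊕ Dn X)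
    ((shuffle (Up X) (Up Y) (Dn Y) (Dn Z)).trans ((f.sumCongr g).trans ((Equiv.sumComm _ _).trans
      (shuffle (Up Z) (Up Y) (Dn Y) (Dn X)).symm)))
  refine ⟨h, l, fun C _ c e => ?_⟩
  refine Eq.trans ?_ (H C (Sum.elim c.1 e.2) (Sum.elim e.1 c.2))
  refine Nat.card_congr ((Equiv.sumArrowEquivProdArrow _ _ _).symm.subtypeEquiv fun d => ?_)
  unfold TraceCompat Compat
  rw [← (shuffle (Up X) (Up Y) (Dn Y) (Dn Z)).symm.forall_congr_right]
  refine Iff.trans ?_ Sum.forall.symm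
  refine and_congr (forall_congr' fun s => ?_) (forall_congr' fun s => ?_)
  · have h1 : Sum.elim (Sum.elim c.1 e.2) ((Equiv.sumArrowEquivProdArrow _ _ _).symm d)
      ((shuffle (Up X) (Up Y) (Dn Y) (Dn Z)).symm (Sum.inl s)) = Sum.elim c.1 d.2 s := by
      rcases s with s | s <;> rfl
    rw [h1]
    simp only [Equiv.trans_apply, Equiv.apply_symm_apply, Equiv.sumCongr_apply, Sum.map_inl]
    rcases f s with t | t <;> rfl
  · have h1 : Sum.elim (Sum.elim c.1 e.2) ((Equiv.sumArrowEquivProdArrow _ _ _).symm d)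
      ((shuffle (Up X) (Up Y) (Dn Y) (Dn Z)).symm (Sum.inr s)) = Sum.elim d.1 e.2 s := by
      rcases s with s | s <;> rfl
    rw [h1]
    simp only [Equiv.trans_apply, Equiv.apply_symm_apply, Equiv.sumCongr_apply, Sum.map_inr]
    rcases g s with t | t <;> rfl

/-- Compatible colourings are the functions on the set of components. -/
theorem compat_iff_strand {C : Type} (f : OBDiagram X Y) (g : OBDiagram Y Z) (c : Col C X)
    (d : Col C Y) (e : Col C Z) : (Compat f c d ∧ Compat g d e) ↔
      ∀ p q, Strand f g p q →
        Sum.elim (Sum.elim c.1 c.2) (Sum.elim (Sum.elim d.1 d.2) (Sum.elim e.1 e.2)) p =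
        Sum.elim (Sum.elim c.1 c.2) (Sum.elim (Sum.elim d.1 d.2) (Sum.elim e.1 e.2)) q := by
  constructor
  · rintro ⟨h1, h2⟩ p q (s | s)
    · have := h1 s
      rcases s with s | s <;> rcases hs : f _ with t | t <;> rw [hs] at this <;> exact this
    · have := h2 s
      rcases s with s | s <;> rcases hs : g _ with t | t <;> rw [hs] at this <;> exact this
  · intro h
    refine ⟨fun s => ?_, fun s => ?_⟩
    · have := h _ _ (Strand.bot s)
      rcases s with s | s <;> rcases hs : f _ with t | t <;> rw [hs] at this <;> exact this
    · have := h _ _ (Strand.top s)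
      rcases s with s | s <;> rcases hs : g _ with t | t <;> rw [hs] at this <;> exact this

/-- The component colouring: the colour of a point is its component. -/
theorem compat_component (f : OBDiagram X Y) (g : OBDiagram Y Z) :
    Compat f (C := Component f g)
      ⟨fun x => Quot.mk _ (.inl (.inl x)), fun x => Quot.mk _ (.inl (.inr x))⟩
      ⟨fun y => Quot.mk _ (.inr (.inl (.inl y))), fun y => Quot.mk _ (.inr (.inl (.inr y)))⟩ ∧
    Compat g (C := Component f g)
      ⟨fun y => Quot.mk _ (.inr (.inl (.inl y))), fun y => Quot.mk _ (.inr (.inl (.inr y)))⟩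
      ⟨fun z => Quot.mk _ (.inr (.inr (.inl z))), fun z => Quot.mk _ (.inr (.inr (.inr z)))⟩ := by
  rw [compat_iff_strand]
  have : ∀ p : GluePt X Y Z, Sum.elim
      (Sum.elim (fun x => (Quot.mk _ (.inl (.inl x)) : Component f g))
        fun x => Quot.mk _ (.inl (.inr x)))
      (Sum.elim (Sum.elim (fun y => Quot.mk _ (.inr (.inl (.inl y))))
        fun y => Quot.mk _ (.inr (.inl (.inr y))))
      (Sum.elim (fun z => Quot.mk _ (.inr (.inr (.inl z))))
        fun z => Quot.mk _ (.inr (.inr (.inr z))))) p = Quot.mk _ p := by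
    rintro ((p | p) | (p | p) | (p | p)) <;> rfl
  intro p q h
  rw [this, this]
  exact Quot.sound h

instance (f : OBDiagram X Y) (g : OBDiagram Y Z) : Finite (Component f g) :=
  Finite.of_surjective (Quot.mk _) Quot.mk_surjective

open Classical in
/-- Following strands from a free starting point, one ends in a free end point. -/
theorem exists_comp (f : OBDiagram X Y) (g : OBDiagram Y Z) :
    ∃ h : OBDiagram X Z, ∀ s, startComponent f g s = endComponent f g (h s) := by
  obtain ⟨h, l, H⟩ := exists_glue f g
  refine ⟨h, fun s => ?_⟩
  obtain ⟨h1, h2⟩ := compat_component f g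
  have H1 := H (Component f g)
    ⟨fun x => Quot.mk _ (.inl (.inl x)), fun x => Quot.mk _ (.inl (.inr x))⟩
    ⟨fun z => Quot.mk _ (.inr (.inr (.inl z))), fun z => Quot.mk _ (.inr (.inr (.inr z)))⟩
  by_cases hc : Compat h (C := Component f g)
    ⟨fun x => Quot.mk _ (.inl (.inl x)), fun x => Quot.mk _ (.inl (.inr x))⟩
    ⟨fun z => Quot.mk _ (.inr (.inr (.inl z))), fun z => Quot.mk _ (.inr (.inr (.inr z)))⟩
  · have := hc s
    unfold startComponent endComponent
    rcases s with s | s <;> rcases hs : h _ with t | t <;> rw [hs] at this <;> exact this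
  · rw [if_neg hc, Finite.card_eq_zero_iff] at H1
    exact (H1.false ⟨_, h1, h2⟩).elim

/-- The composite diagram with its closed loops removed: the start of each strand lies in the same
component of the stacked picture as its end. -/
noncomputable def comp (f : OBDiagram X Y) (g : OBDiagram Y Z) : OBDiagram X Z :=
  (exists_comp f g).choose

theorem comp_spec (f : OBDiagram X Y) (g : OBDiagram Y Z) (s : Up X ⊕ Dn Z) :
    startComponent f g s = endComponent f g (comp f g s) :=
  (exists_comp f g).choose_spec s

theorem compat_comp {C : Type} {f : OBDiagram X Y} {g : OBDiagram Y Z} {c : Col C X}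
    {d : Col C Y} {e : Col C Z} (h1 : Compat f c d) (h2 : Compat g d e) :
    Compat (comp f g) c e := by
  have h := (compat_iff_strand f g c d e).1 ⟨h1, h2⟩
  intro s
  have h3 := congrArg (Quot.lift _ h) (comp_spec f g s)
  unfold startComponent endComponent at h3
  rcases s with s | s <;> rcases hs : comp f g _ with t | t <;> rw [hs] at h3 <;> exact h3

/-- A diagram is determined by its compatible colourings. -/
theorem ext_of_compat {h h' : OBDiagram X Z}
    (H : ∀ (c : Col Bool X) (e : Col Bool Z), Compat h c e → Compat h' c e) : h = h' := by
  classical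
  ext s : 1
  have h1 := H ⟨fun x => decide (h (.inl x) = h s), fun x => decide (.inr x = h s)⟩
    ⟨fun z => decide (.inl z = h s), fun z => decide (h (.inr z) = h s)⟩ (by
      intro t
      generalize h s = r
      rcases t with t | t
      · simp only [Sum.elim_inl]
        generalize h (Sum.inl t) = q
        rcases q with q | q <;> rfl
      · simp only [Sum.elim_inr]
        generalize h (Sum.inr t) = q
        rcases q with q | q <;> rfl) s
  rcases s with s | s <;> rcases ht : h' _ with r | r <;> rw [ht] at h1 <;>
    simpa [eq_comm] using h1

theorem card_inner (f : OBDiagram X Y) (g : OBDiagram Y Z) :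
    Nat.card {d : Col Bool Y // Compat f ⟨fun _ => true, fun _ => true⟩ d ∧
      Compat g d ⟨fun _ => true, fun _ => true⟩} = 2 ^ loops f g := by
  classical
  let In : Component f g → Prop := fun c =>
    (∀ x, Quot.mk _ (.inl x) ≠ c) ∧ (∀ z, Quot.mk _ (.inr (.inr z)) ≠ c)
  let col : Col Bool Y → GluePt X Y Z → Bool := fun d =>
    Sum.elim (Sum.elim (fun _ => true) (fun _ => true))
      (Sum.elim (Sum.elim d.1 d.2) (Sum.elim (fun _ => true) (fun _ => true)))
  have hout : ∀ (d : Col Bool Y) (hd : ∀ p q, Strand f g p q → col d p = col d q)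
      (q : Component f g), ¬ In q → Quot.lift (col d) hd q = true := by
    intro d hd q hq
    simp only [In, not_and_or, not_forall, not_not] at hq
    rcases hq with ⟨x | x, rfl⟩ | ⟨z | z, rfl⟩ <;> rfl
  let G : ({c // In c} → Bool) → Component f g → Bool := fun F q =>
    if h : In q then F ⟨q, h⟩ else true
  have hG : ∀ F p, col ⟨fun y => G F (Quot.mk _ (.inr (.inl (.inl y)))),
      fun y => G F (Quot.mk _ (.inr (.inl (.inr y))))⟩ p = G F (Quot.mk _ p) := by
    intro F p
    rcases p with (p | p) | (p | p) | (p | p)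
    · exact (show G F _ = true from dif_neg fun h => h.1 (.inl p) rfl).symm
    · exact (show G F _ = true from dif_neg fun h => h.1 (.inr p) rfl).symm
    · rfl
    · rfl
    · exact (show G F _ = true from dif_neg fun h => h.2 (.inl p) rfl).symm
    · exact (show G F _ = true from dif_neg fun h => h.2 (.inr p) rfl).symm
  have e : {d : Col Bool Y // Compat f ⟨fun _ => true, fun _ => true⟩ d ∧
      Compat g d ⟨fun _ => true, fun _ => true⟩} ≃ ({c // In c} → Bool) :=
    { toFun := fun d q => Quot.lift (col d.1) ((compat_iff_strand f g _ _ _).1 d.2) q.1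
      invFun := fun F => ⟨⟨fun y => G F (Quot.mk _ (.inr (.inl (.inl y)))),
          fun y => G F (Quot.mk _ (.inr (.inl (.inr y))))⟩, (compat_iff_strand f g _ _ _).2 (by
            intro p q hpq
            exact (hG F p).trans ((congrArg (G F) (Quot.sound hpq)).trans (hG F q).symm))⟩
      left_inv := by
        rintro ⟨d, hd⟩
        have hd' := (compat_iff_strand f g _ _ _).1 hd
        have : ∀ p, G (fun q => Quot.lift (col d) hd' q.1) (Quot.mk _ p) = col d p := by
          intro p
          by_cases h : In (Quot.mk _ p)
          · exact dif_pos h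
          · exact (dif_neg h).trans (hout d hd' _ h).symm
        apply Subtype.ext
        apply Prod.ext
        · funext y; exact this _
        · funext y; exact this _
      right_inv := by
        intro F
        funext q
        obtain ⟨q, hq⟩ := q
        obtain ⟨p, rfl⟩ := Quot.mk_surjective q
        exact (hG F p).trans (dif_pos hq) }
  rw [Nat.card_congr e, Nat.card_fun]
  simp [loops, In]

theorem compat_true (h : OBDiagram X Z) :
    Compat h ⟨fun _ => true, fun _ => true⟩ ⟨fun _ => true, fun _ => true⟩ := by
  rintro s
  rcases s with s | s <;> rcases h _ with t | t <;> rfl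

open Classical in
/-- Composition is characterised by counting the colourings of the middle word. -/
theorem comp_unique {f : OBDiagram X Y} {g : OBDiagram Y Z} {h : OBDiagram X Z} {l : ℕ}
    (H : ∀ (c : Col Bool X) (e : Col Bool Z),
      Nat.card {d : Col Bool Y // Compat f c d ∧ Compat g d e} =
        if Compat h c e then 2 ^ l else 0) : comp f g = h ∧ loops f g = l := by
  constructor
  · refine (ext_of_compat fun c e hc => ?_).symm
    have h1 := H c e
    rw [if_pos hc] at h1
    have h2 : 0 < Nat.card {d : Col Bool Y // Compat f c d ∧ Compat g d e} := by
      rw [h1]; positivity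
    obtain ⟨⟨d, hd⟩⟩ := (Nat.card_pos_iff.1 h2).1
    exact compat_comp hd.1 hd.2
  · have h1 := H ⟨fun _ => true, fun _ => true⟩ ⟨fun _ => true, fun _ => true⟩
    rw [card_inner, if_pos (compat_true h)] at h1
    exact Nat.pow_right_injective le_rfl h1

open Classical in
/-- Counting the colourings of the middle word of a composite. -/
theorem card_compat (f : OBDiagram X Y) (g : OBDiagram Y Z) (c : Col Bool X) (e : Col Bool Z) :
    Nat.card {d : Col Bool Y // Compat f c d ∧ Compat g d e} =
      if Compat (comp f g) c e then 2 ^ loops f g else 0 := by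
  obtain ⟨h, l, H⟩ := exists_glue f g
  have H' := H Bool
  simp only [Nat.card_eq_fintype_card (α := Bool), Fintype.card_bool] at H'
  obtain ⟨h1, h2⟩ := comp_unique H'
  rw [h1, h2, H' c e]

open Classical in
theorem sum_compat [Fintype (Col Bool Y)] (f : OBDiagram X Y) (g : OBDiagram Y Z)
    (c : Col Bool X) (e : Col Bool Z) :
    ∑ d : Col Bool Y, (if Compat f c d then 1 else 0) * (if Compat g d e then 1 else 0) =
      2 ^ loops f g * (if Compat (comp f g) c e then 1 else 0) := by
  have := card_compat f g c e
  rw [Nat.card_eq_fintype_card, Fintype.card_subtype, Finset.card_filter] at this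
  simp only [mul_ite, mul_one, mul_zero]
  rw [← this]
  refine Finset.sum_congr rfl fun d _ => ?_
  by_cases h1 : Compat f c d <;> by_cases h2 : Compat g d e <;> simp [h1, h2]

open Classical in
theorem comp_assoc (f : OBDiagram X Y) (g : OBDiagram Y Z) (h : OBDiagram Z W) :
    comp (comp f g) h = comp f (comp g h) ∧
      loops f g + loops (comp f g) h = loops g h + loops f (comp g h) := by
  have key : ∀ (c : Col Bool X) (e : Col Bool W),
      2 ^ (loops f g + loops (comp f g) h) * (if Compat (comp (comp f g) h) c e then 1 else 0) =
      2 ^ (loops g h + loops f (comp g h)) *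
        (if Compat (comp f (comp g h)) c e then 1 else 0) := by
    intro c e
    let _ : ∀ X : OBWord, Fintype (Col Bool X) := fun X => Fintype.ofFinite _
    rw [pow_add, pow_add, mul_assoc, mul_assoc, ← sum_compat, ← sum_compat, Finset.mul_sum,
      Finset.mul_sum]
    simp only [← mul_assoc, ← sum_compat]
    simp only [mul_comm _ (if Compat f c _ then 1 else 0 : ℕ), mul_assoc, ← sum_compat]
    simp only [Finset.sum_mul, Finset.mul_sum]
    rw [Finset.sum_comm]
    simp only [mul_assoc]
  have hl : loops f g + loops (comp f g) h = loops g h + loops f (comp g h) := by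
    have := key ⟨fun _ => true, fun _ => true⟩ ⟨fun _ => true, fun _ => true⟩
    rw [if_pos (compat_true _), if_pos (compat_true _), mul_one, mul_one] at this
    exact Nat.pow_right_injective le_rfl this
  refine ⟨ext_of_compat fun c e hc => ?_, hl⟩
  have := key c e
  rw [if_pos hc, hl] at this
  by_contra h0
  rw [if_neg h0] at this
  simp at this

/-- The diagrams without cups and caps. -/
def perm (e : Up X ≃ Up Y) (d : Dn X ≃ Dn Y) : OBDiagram X Y := e.sumCongr d.symm

theorem compat_perm {C : Type} {e : Up X ≃ Up Y} {d : Dn X ≃ Dn Y} {a : Col C X} {b : Col C Y} :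
    Compat (perm e d) a b ↔ b = ⟨a.1 ∘ e.symm, a.2 ∘ d.symm⟩ := by
  constructor
  · intro h
    apply Prod.ext
    · funext y
      simpa [perm] using (h (.inl (e.symm y))).symm
    · funext y
      exact h (.inr y)
  · rintro rfl s
    rcases s with s | s
    · simp [perm]
    · rfl

open Classical in
theorem card_eq_and {α : Type} (v : α) (P : α → Prop) :
    Nat.card {d : α // d = v ∧ P d} = if P v then 2 ^ 0 else 0 := by
  split_ifs with h
  · have : Unique {d : α // d = v ∧ P d} := ⟨⟨⟨v, rfl, h⟩⟩, fun d => Subtype.ext d.2.1⟩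
    simp
  · have : IsEmpty {d : α // d = v ∧ P d} := ⟨fun d => h (d.2.1 ▸ d.2.2)⟩
    simp

theorem perm_comp (e : Up X ≃ Up Y) (d : Dn X ≃ Dn Y) (g : OBDiagram Y Z) :
    comp (perm e d) g = (e.sumCongr (Equiv.refl _)).trans (Equiv.trans g
      ((Equiv.refl _).sumCongr d.symm)) ∧ loops (perm e d) g = 0 := by
  classical
  apply comp_unique
  intro a c
  simp only [compat_perm]
  rw [card_eq_and]
  refine if_congr ?_ rfl rfl
  unfold Compat
  rw [← (e.sumCongr (Equiv.refl _)).forall_congr_right]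
  refine forall_congr' fun s => ?_
  simp only [Equiv.trans_apply]
  generalize g _ = t
  rcases s with s | s <;> rcases t with t | t <;> simp

theorem comp_perm (f : OBDiagram X Y) (e : Up Y ≃ Up Z) (d : Dn Y ≃ Dn Z) :
    comp f (perm e d) = ((Equiv.refl _).sumCongr d.symm).trans (Equiv.trans f
      (e.sumCongr (Equiv.refl _))) ∧ loops f (perm e d) = 0 := by
  classical
  apply comp_unique
  intro a c
  have h : ∀ b : Col Bool Y, Compat f a b ∧ Compat (perm e d) b c ↔
      b = ⟨c.1 ∘ e, c.2 ∘ d⟩ ∧ Compat f a b := by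
    intro b
    rw [compat_perm, and_comm]
    refine and_congr_left fun _ => ?_
    constructor
    · rintro rfl
      ext <;> simp
    · rintro rfl
      ext <;> simp
  simp only [h]
  rw [card_eq_and]
  refine if_congr ?_ rfl rfl
  unfold Compat
  rw [← ((Equiv.refl _).sumCongr d).forall_congr_right]
  refine forall_congr' fun s => ?_
  have hs : ((Equiv.refl (Up X)).sumCongr d.symm) (((Equiv.refl _).sumCongr d) s) = s := by
    rcases s with s | s <;> simp
  simp only [Equiv.trans_apply, hs]
  generalize f _ = t
  rcases s with s | s <;> rcases t with t | t <;> simp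

/-- The tensor product of diagrams: put them side by side. -/
def tensor (f : OBDiagram X Y) (g : OBDiagram X' Y') :
    OBDiagram (X.tensor X') (Y.tensor Y') :=
  (Equiv.sumSumSumComm (Up X) (Up X') (Dn Y) (Dn Y')).trans
    ((f.sumCongr g).trans (Equiv.sumSumSumComm (Up Y) (Dn X) (Up Y') (Dn X')))

def colTensor (C : Type) (X Y : OBWord) : Col C (X.tensor Y) ≃ Col C X × Col C Y :=
  ((Equiv.sumArrowEquivProdArrow _ _ _).prodCongr (Equiv.sumArrowEquivProdArrow _ _ _)).trans
    (Equiv.prodProdProdComm _ _ _ _)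

theorem compat_tensor {C : Type} {f : OBDiagram X Y} {g : OBDiagram X' Y'}
    {a : Col C (X.tensor X')} {b : Col C (Y.tensor Y')} :
    Compat (tensor f g) a b ↔ Compat f (colTensor C X X' a).1 (colTensor C Y Y' b).1 ∧
      Compat g (colTensor C X X' a).2 (colTensor C Y Y' b).2 := by
  unfold Compat
  refine ((Equiv.sumSumSumComm (Up X) (Up X') (Dn Y) (Dn Y')).symm.forall_congr_right).symm.trans ?_
  refine Iff.trans Sum.forall ?_
  refine and_congr (forall_congr' fun s => ?_) (forall_congr' fun s => ?_)
  · have h1 : tensor f g ((Equiv.sumSumSumComm (Up X) (Up X') (Dn Y) (Dn Y')).symm (Sum.inl s)) =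
      Equiv.sumSumSumComm (Up Y) (Dn X) (Up Y') (Dn X') (Sum.inl (f s)) := by
      rcases s with s | s <;> rfl
    rw [h1]
    generalize f s = t
    rcases s with s | s <;> rcases t with t | t <;> rfl
  · have h1 : tensor f g ((Equiv.sumSumSumComm (Up X) (Up X') (Dn Y) (Dn Y')).symm (Sum.inr s)) =
      Equiv.sumSumSumComm (Up Y) (Dn X) (Up Y') (Dn X') (Sum.inr (g s)) := by
      rcases s with s | s <;> rfl
    rw [h1]
    generalize g s = t
    rcases s with s | s <;> rcases t with t | t <;> rfl

theorem tensor_comp (f : OBDiagram X Y) (f' : OBDiagram X' Y') (g : OBDiagram Y Z)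
    (g' : OBDiagram Y' Z') :
    comp (tensor f f') (tensor g g') = tensor (comp f g) (comp f' g') ∧
      loops (tensor f f') (tensor g g') = loops f g + loops f' g' := by
  classical
  apply comp_unique
  intro a c
  have e : {b : Col Bool (Y.tensor Y') // Compat (tensor f f') a b ∧ Compat (tensor g g') b c} ≃
      {b : Col Bool Y // Compat f (colTensor Bool X X' a).1 b ∧
        Compat g b (colTensor Bool Z Z' c).1} ×
      {b : Col Bool Y' // Compat f' (colTensor Bool X X' a).2 b ∧
        Compat g' b (colTensor Bool Z Z' c).2} := by
    refine Equiv.trans ((colTensor Bool Y Y').subtypeEquiv fun b => ?_)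
      (Equiv.subtypeProdEquivProd (p := fun b => Compat f (colTensor Bool X X' a).1 b ∧
        Compat g b (colTensor Bool Z Z' c).1) (q := fun b => Compat f' (colTensor Bool X X' a).2 b ∧
        Compat g' b (colTensor Bool Z Z' c).2))
    rw [compat_tensor, compat_tensor, and_and_and_comm]
  rw [Nat.card_congr e, Nat.card_prod, card_compat, card_compat, compat_tensor]
  split_ifs <;> first | tauto | simp [pow_add]


theorem tensor_perm (e : Up X ≃ Up Y) (d : Dn X ≃ Dn Y) (e' : Up X' ≃ Up Y') (d' : Dn X' ≃ Dn Y') :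
    tensor (perm e d) (perm e' d') = perm (upCongr e e') (dnCongr d d') := by
  ext s
  rcases s with (s | s) | (s | s) <;> rfl

open Classical in
theorem compat_perm_comp {e : Up X ≃ Up Y} {d : Dn X ≃ Dn Y} {g : OBDiagram Y Z}
    {a : Col Bool X} {c : Col Bool Z} :
    Compat (comp (perm e d) g) a c ↔ Compat g ⟨a.1 ∘ e.symm, a.2 ∘ d.symm⟩ c := by
  have h := card_compat (perm e d) g a c
  simp only [compat_perm] at h
  rw [card_eq_and, (perm_comp e d g).2] at h
  split_ifs at h <;> simp_all

open Classical in
theorem compat_comp_perm {f : OBDiagram X Y} {e : Up Y ≃ Up Z} {d : Dn Y ≃ Dn Z}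
    {a : Col Bool X} {c : Col Bool Z} :
    Compat (comp f (perm e d)) a c ↔ Compat f a ⟨c.1 ∘ e, c.2 ∘ d⟩ := by
  constructor
  · intro h
    have h1 := card_compat f (perm e d) a c
    rw [if_pos h] at h1
    have h2 : 0 < Nat.card {b : Col Bool Y // Compat f a b ∧ Compat (perm e d) b c} := by
      rw [h1]; positivity
    obtain ⟨⟨b, hb, hb'⟩⟩ := (Nat.card_pos_iff.1 h2).1
    rw [compat_perm] at hb'
    subst hb'
    convert hb using 1
    ext <;> simp
  · intro h
    refine compat_comp h ?_
    rw [compat_perm]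
    ext <;> simp

end OBDiagram

open OBDiagram

/-- Linear combinations of oriented Brauer diagrams. -/
abbrev OBHom (k : Type w) [Field k] (X Y : OBWord) : Type w := OBDiagram X Y →₀ k

namespace OBHom

variable {k : Type w} [Field k] (δ : k) {X Y Z W X' Y' Z' X'' Y'' Z'' : OBWord}

/-- The composition of linear combinations of diagrams: bilinear, with each closed loop replaced by
the factor `δ`. -/
noncomputable def comp : OBHom k X Y →ₗ[k] OBHom k Y Z →ₗ[k] OBHom k X Z :=
  Finsupp.linearCombination k fun f => Finsupp.linearCombination k fun g =>
    Finsupp.single (OBDiagram.comp f g) (δ ^ loops f g)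

/-- The tensor product, extended bilinearly. -/
noncomputable def tensor :
    OBHom k X Y →ₗ[k] OBHom k X' Y' →ₗ[k] OBHom k (X.tensor X') (Y.tensor Y') :=
  Finsupp.linearCombination k fun f => Finsupp.linearCombination k fun g =>
    Finsupp.single (OBDiagram.tensor f g) 1

/-- The morphism given by a diagram without cups and caps. -/
noncomputable def perm (e : Up X ≃ Up Y) (d : Dn X ≃ Dn Y) : OBHom k X Y :=
  Finsupp.single (OBDiagram.perm e d) 1

theorem perm_def (e : Up X ≃ Up Y) (d : Dn X ≃ Dn Y) :
    perm e d = (Finsupp.single (OBDiagram.perm e d) 1 : OBHom k X Y) := rfl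

theorem add_comp (f f' : OBHom k X Y) (g : OBHom k Y Z) :
    comp δ (f + f') g = comp δ f g + comp δ f' g := by
  simp only [map_add, LinearMap.add_apply]

theorem smul_comp (r : k) (f : OBHom k X Y) (g : OBHom k Y Z) :
    comp δ (r • f) g = r • comp δ f g := by
  simp only [map_smul, LinearMap.smul_apply]

theorem comp_add (f : OBHom k X Y) (g g' : OBHom k Y Z) :
    comp δ f (g + g') = comp δ f g + comp δ f g' := by
  simp only [map_add]

theorem comp_smul (f : OBHom k X Y) (r : k) (g : OBHom k Y Z) :
    comp δ f (r • g) = r • comp δ f g := by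
  simp only [map_smul]

theorem comp_single (f : OBDiagram X Y) (g : OBDiagram Y Z) (a b : k) :
    comp δ (Finsupp.single f a) (Finsupp.single g b) =
      Finsupp.single (OBDiagram.comp f g) (a * b * δ ^ loops f g) := by
  simp only [comp, Finsupp.linearCombination_single, LinearMap.smul_apply, Finsupp.smul_single,
    smul_eq_mul, mul_assoc]

theorem tensor_zero (f : OBHom k X Y) : tensor f (0 : OBHom k X' Y') = 0 := map_zero _

theorem zero_tensor (g : OBHom k X' Y') : tensor (0 : OBHom k X Y) g = 0 := by
  simp only [map_zero, LinearMap.zero_apply]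

theorem tensor_add (f : OBHom k X Y) (g g' : OBHom k X' Y') :
    tensor f (g + g') = tensor f g + tensor f g' := map_add _ _ _

theorem add_tensor (f f' : OBHom k X Y) (g : OBHom k X' Y') :
    tensor (f + f') g = tensor f g + tensor f' g := by
  simp only [map_add, LinearMap.add_apply]

theorem tensor_smul (f : OBHom k X Y) (r : k) (g : OBHom k X' Y') :
    tensor f (r • g) = r • tensor f g := map_smul _ _ _

theorem smul_tensor (r : k) (f : OBHom k X Y) (g : OBHom k X' Y') :
    tensor (r • f) g = r • tensor f g := by
  simp only [map_smul, LinearMap.smul_apply]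

theorem tensor_single (f : OBDiagram X Y) (g : OBDiagram X' Y') (a b : k) :
    tensor (Finsupp.single f a) (Finsupp.single g b) =
      Finsupp.single (OBDiagram.tensor f g) (a * b) := by
  simp only [tensor, Finsupp.linearCombination_single, LinearMap.smul_apply, Finsupp.smul_single,
    smul_eq_mul, mul_one]

theorem perm_comp_perm (e : Up X ≃ Up Y) (d : Dn X ≃ Dn Y) (e' : Up Y ≃ Up Z) (d' : Dn Y ≃ Dn Z) :
    comp δ (perm e d) (perm e' d') = perm (k := k) (e.trans e') (d.trans d') := by
  obtain ⟨h1, h2⟩ := OBDiagram.perm_comp e d (OBDiagram.perm e' d')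
  rw [perm_def, perm_def, comp_single, h1, h2, perm_def]
  have : ((e.sumCongr (Equiv.refl _)).trans (Equiv.trans (OBDiagram.perm e' d')
      ((Equiv.refl _).sumCongr d.symm))) = OBDiagram.perm (e.trans e') (d.trans d') := by
    ext s
    rcases s with s | s <;> rfl
  rw [this]
  simp

theorem tensor_perm_perm (e : Up X ≃ Up Y) (d : Dn X ≃ Dn Y) (e' : Up X' ≃ Up Y')
    (d' : Dn X' ≃ Dn Y') :
    tensor (perm e d) (perm e' d') = perm (k := k) (upCongr e e') (dnCongr d d') := by
  rw [perm_def, perm_def, tensor_single, tensor_perm, perm_def, mul_one]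

theorem id_comp (f : OBHom k X Y) : comp δ (perm (Equiv.refl _) (Equiv.refl _)) f = f := by
  induction f using Finsupp.induction_linear with
  | zero => simp
  | add f g hf hg => simp [hf, hg]
  | single f a =>
    obtain ⟨h1, h2⟩ := OBDiagram.perm_comp (Equiv.refl _) (Equiv.refl _) f
    rw [perm_def, comp_single, h1, h2]
    simp [Equiv.sumCongr_refl]

theorem comp_id (f : OBHom k X Y) : comp δ f (perm (Equiv.refl _) (Equiv.refl _)) = f := by
  induction f using Finsupp.induction_linear with
  | zero => simp
  | add f g hf hg => simp [hf, hg]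
  | single f a =>
    obtain ⟨h1, h2⟩ := OBDiagram.comp_perm f (Equiv.refl _) (Equiv.refl _)
    rw [perm_def, comp_single, h1, h2]
    simp [Equiv.sumCongr_refl]

theorem assoc (f : OBHom k X Y) (g : OBHom k Y Z) (h : OBHom k Z W) :
    comp δ (comp δ f g) h = comp δ f (comp δ g h) := by
  induction f using Finsupp.induction_linear with
  | zero => simp
  | add f f' hf hf' => simp [hf, hf']
  | single f a =>
  induction g using Finsupp.induction_linear with
  | zero => simp
  | add f f' hf hf' => simp [hf, hf']
  | single g b =>
  induction h using Finsupp.induction_linear with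
  | zero => simp
  | add f f' hf hf' => simp [hf, hf']
  | single h c =>
    obtain ⟨h1, h2⟩ := comp_assoc f g h
    simp only [comp_single]
    rw [h1]
    congr 1
    have h3 := congrArg (δ ^ ·) h2
    simp only [pow_add] at h3
    linear_combination (a * b * c) * h3

theorem tensor_comp_tensor (f : OBHom k X Y) (f' : OBHom k X' Y') (g : OBHom k Y Z)
    (g' : OBHom k Y' Z') :
    comp δ (tensor f f') (tensor g g') = tensor (comp δ f g) (comp δ f' g') := by
  induction f using Finsupp.induction_linear with
  | zero => simp
  | add f f' hf hf' => simp [hf, hf']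
  | single f a =>
  induction g using Finsupp.induction_linear with
  | zero => simp
  | add f f' hf hf' => simp [hf, hf']
  | single g b =>
  induction f' using Finsupp.induction_linear with
  | zero => simp
  | add f f' hf hf' => simp [hf, hf']
  | single f' c =>
  induction g' using Finsupp.induction_linear with
  | zero => simp
  | add f f' hf hf' => simp [hf, hf']
  | single g' d =>
    obtain ⟨h1, h2⟩ := tensor_comp f f' g g'
    simp only [comp_single, tensor_single]
    rw [h1, h2]
    congr 1
    ring

/-- The associator. -/
noncomputable def assocHom (X Y Z : OBWord) :
    OBHom k ((X.tensor Y).tensor Z) (X.tensor (Y.tensor Z)) :=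
  perm (upAssoc X Y Z) (dnAssoc X Y Z)

/-- The left unitor. -/
noncomputable def leftUnitorHom (X : OBWord) : OBHom k (OBWord.one.tensor X) X :=
  perm (upOneTensor X) (dnOneTensor X)

/-- The right unitor. -/
noncomputable def rightUnitorHom (X : OBWord) : OBHom k (X.tensor OBWord.one) X :=
  perm (upTensorOne X) (dnTensorOne X)

/-- The braiding. -/
noncomputable def braidHom (X Y : OBWord) : OBHom k (X.tensor Y) (Y.tensor X) :=
  perm (upComm X Y) (dnComm X Y)

theorem assoc_naturality (f : OBHom k X Y) (f' : OBHom k X' Y') (f'' : OBHom k X'' Y'') :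
    comp δ (tensor (tensor f f') f'') (assocHom Y Y' Y'') =
      comp δ (assocHom X X' X'') (tensor f (tensor f' f'')) := by
  induction f using Finsupp.induction_linear with
  | zero => simp
  | add f f' hf hf' => simp [hf, hf']
  | single f a =>
  induction f' using Finsupp.induction_linear with
  | zero => simp
  | add f f' hf hf' => simp [hf, hf']
  | single f' b =>
  induction f'' using Finsupp.induction_linear with
  | zero => simp
  | add f f' hf hf' => simp [hf, hf']
  | single f'' c =>
    rw [assocHom, assocHom, perm_def, perm_def, tensor_single, tensor_single, tensor_single, tensor_single,
      comp_single, comp_single, (OBDiagram.comp_perm _ _ _).2, (OBDiagram.perm_comp _ _ _).2]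
    congr 1
    · refine ext_of_compat fun u v => ?_
      rw [compat_comp_perm, compat_perm_comp, compat_tensor, compat_tensor, compat_tensor,
        compat_tensor, and_assoc]
      exact id
    · ring

theorem leftUnitor_naturality (f : OBHom k X Y) :
    comp δ (tensor (perm (Equiv.refl (Up OBWord.one)) (Equiv.refl (Dn OBWord.one))) f)
      (leftUnitorHom Y) = comp δ (leftUnitorHom X) f := by
  induction f using Finsupp.induction_linear with
  | zero => simp
  | add f f' hf hf' => simp [hf, hf']
  | single f a =>
    rw [leftUnitorHom, leftUnitorHom, perm_def, perm_def, perm_def, tensor_single,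
      comp_single, comp_single, (OBDiagram.comp_perm _ _ _).2, (OBDiagram.perm_comp _ _ _).2]
    congr 1
    · refine ext_of_compat fun u v => ?_
      rw [compat_comp_perm, compat_perm_comp, compat_tensor]
      exact fun h => h.2
    · ring

theorem rightUnitor_naturality (f : OBHom k X Y) :
    comp δ (tensor f (perm (Equiv.refl (Up OBWord.one)) (Equiv.refl (Dn OBWord.one))))
      (rightUnitorHom Y) = comp δ (rightUnitorHom X) f := by
  induction f using Finsupp.induction_linear with
  | zero => simp
  | add f f' hf hf' => simp [hf, hf']
  | single f a =>
    rw [rightUnitorHom, rightUnitorHom, perm_def, perm_def, perm_def, tensor_single,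
      comp_single, comp_single, (OBDiagram.comp_perm _ _ _).2, (OBDiagram.perm_comp _ _ _).2]
    congr 1
    · refine ext_of_compat fun u v => ?_
      rw [compat_comp_perm, compat_perm_comp, compat_tensor]
      exact fun h => h.1
    · ring

theorem braid_naturality (f : OBHom k X Y) (f' : OBHom k X' Y') :
    comp δ (tensor f f') (braidHom Y Y') = comp δ (braidHom X X') (tensor f' f) := by
  induction f using Finsupp.induction_linear with
  | zero => simp
  | add f f' hf hf' => simp [hf, hf']
  | single f a =>
  induction f' using Finsupp.induction_linear with
  | zero => simp
  | add f f' hf hf' => simp [hf, hf']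
  | single f' b =>
    rw [braidHom, braidHom, perm_def, perm_def, tensor_single, tensor_single,
      comp_single, comp_single, (OBDiagram.comp_perm _ _ _).2, (OBDiagram.perm_comp _ _ _).2]
    congr 1
    · refine ext_of_compat fun u v => ?_
      rw [compat_comp_perm, compat_perm_comp, compat_tensor, compat_tensor, and_comm]
      exact id
    · ring

theorem pentagon (W X Y Z : OBWord) :
    comp δ (tensor (assocHom W X Y) (perm (Equiv.refl (Up Z)) (Equiv.refl (Dn Z))))
      (comp δ (assocHom W (X.tensor Y) Z)
        (tensor (perm (Equiv.refl (Up W)) (Equiv.refl (Dn W))) (assocHom X Y Z))) =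
    comp (k := k) δ (assocHom (W.tensor X) Y Z) (assocHom W X (Y.tensor Z)) := by
  simp only [assocHom, tensor_perm_perm, perm_comp_perm]
  congr 1 <;> ext s <;> rcases s with ((s | s) | s) | s <;> rfl

theorem triangle (X Y : OBWord) :
    comp δ (assocHom X OBWord.one Y)
      (tensor (perm (Equiv.refl (Up X)) (Equiv.refl (Dn X))) (leftUnitorHom Y)) =
    tensor (k := k) (rightUnitorHom X) (perm (Equiv.refl (Up Y)) (Equiv.refl (Dn Y))) := by
  simp only [assocHom, leftUnitorHom, rightUnitorHom, tensor_perm_perm, perm_comp_perm]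
  congr 1 <;> ext s <;> rcases s with (s | s) | s <;> first | rfl | exact s.elim

theorem hexagon_forward (X Y Z : OBWord) :
    comp δ (assocHom X Y Z) (comp δ (braidHom X (Y.tensor Z)) (assocHom Y Z X)) =
    comp (k := k) δ (tensor (braidHom X Y) (perm (Equiv.refl (Up Z)) (Equiv.refl (Dn Z))))
      (comp δ (assocHom Y X Z)
        (tensor (perm (Equiv.refl (Up Y)) (Equiv.refl (Dn Y))) (braidHom X Z))) := by
  simp only [assocHom, braidHom, tensor_perm_perm, perm_comp_perm]
  congr 1 <;> ext s <;> rcases s with (s | s) | s <;> rfl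

theorem hexagon_reverse (X Y Z : OBWord) :
    comp δ (perm (upAssoc X Y Z).symm (dnAssoc X Y Z).symm) (comp δ (braidHom (X.tensor Y) Z)
      (perm (upAssoc Z X Y).symm (dnAssoc Z X Y).symm)) =
    comp (k := k) δ (tensor (perm (Equiv.refl (Up X)) (Equiv.refl (Dn X))) (braidHom Y Z))
      (comp δ (perm (upAssoc X Z Y).symm (dnAssoc X Z Y).symm)
        (tensor (braidHom X Z) (perm (Equiv.refl (Up Y)) (Equiv.refl (Dn Y))))) := by
  simp only [braidHom, tensor_perm_perm, perm_comp_perm]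
  congr 1 <;> ext s <;> rcases s with s | (s | s) <;> rfl

theorem braid_braid (X Y : OBWord) :
    comp (k := k) δ (braidHom X Y) (braidHom Y X) = perm (Equiv.refl _) (Equiv.refl _) := by
  simp only [braidHom, perm_comp_perm]
  congr 1 <;> ext s <;> rcases s with s | s <;> rfl

end OBHom

/-- The oriented Brauer category `OB(δ)` over `k`. -/
structure OB (k : Type w) [Field k] (δ : k) : Type where
  word : OBWord

namespace OB

variable {k : Type w} [Field k] {δ : k}

noncomputable instance : Category (OB k δ) where
  Hom X Y := OBHom k X.word Y.word
  id X := OBHom.perm (Equiv.refl _) (Equiv.refl _)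
  comp f g := OBHom.comp δ f g
  id_comp f := OBHom.id_comp δ f
  comp_id f := OBHom.comp_id δ f
  assoc f g h := OBHom.assoc δ f g h

noncomputable instance : Preadditive (OB k δ) where
  homGroup X Y := inferInstanceAs (AddCommGroup (OBHom k X.word Y.word))
  add_comp _ _ _ f f' g := OBHom.add_comp δ f f' g
  comp_add _ _ _ f g g' := OBHom.comp_add δ f g g'

noncomputable instance : Linear k (OB k δ) where
  homModule X Y := inferInstanceAs (Module k (OBHom k X.word Y.word))
  smul_comp _ _ _ r f g := OBHom.smul_comp δ r f g
  comp_smul _ _ _ f r g := OBHom.comp_smul δ f r g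

/-- The isomorphism given by a diagram without cups and caps. -/
noncomputable def permIso {X Y : OB k δ} (e : Up X.word ≃ Up Y.word)
    (d : Dn X.word ≃ Dn Y.word) : X ≅ Y where
  hom := OBHom.perm e d
  inv := OBHom.perm e.symm d.symm
  hom_inv_id := (OBHom.perm_comp_perm δ _ _ _ _).trans (by simp; rfl)
  inv_hom_id := (OBHom.perm_comp_perm δ _ _ _ _).trans (by simp; rfl)

noncomputable instance : MonoidalCategoryStruct (OB k δ) where
  tensorObj X Y := ⟨X.word.tensor Y.word⟩
  tensorUnit := ⟨OBWord.one⟩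
  tensorHom f g := OBHom.tensor f g
  whiskerLeft X _ _ f := OBHom.tensor (OBHom.perm (Equiv.refl (Up X.word)) (Equiv.refl (Dn X.word))) f
  whiskerRight f Y := OBHom.tensor f (OBHom.perm (Equiv.refl (Up Y.word)) (Equiv.refl (Dn Y.word)))
  associator X Y Z := permIso (upAssoc _ _ _) (dnAssoc _ _ _)
  leftUnitor X := permIso (upOneTensor X.word) (dnOneTensor X.word)
  rightUnitor X := permIso (upTensorOne X.word) (dnTensorOne X.word)

noncomputable instance : MonoidalCategory (OB k δ) := MonoidalCategory.ofTensorHom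
  (id_tensorHom_id := fun X Y => (OBHom.tensor_perm_perm _ _ _ _).trans (by
    rw [upCongr_refl, dnCongr_refl]; rfl))
  (id_tensorHom := fun _ _ _ _ => rfl)
  (tensorHom_id := fun _ _ => rfl)
  (tensorHom_comp_tensorHom := fun f f' g g' => OBHom.tensor_comp_tensor δ f f' g g')
  (associator_naturality := fun f f' f'' => OBHom.assoc_naturality δ f f' f'')
  (leftUnitor_naturality := fun f => OBHom.leftUnitor_naturality δ f)
  (rightUnitor_naturality := fun f => OBHom.rightUnitor_naturality δ f)
  (pentagon := fun W X Y Z => OBHom.pentagon δ W.word X.word Y.word Z.word)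
  (triangle := fun X Y => OBHom.triangle δ X.word Y.word)

noncomputable instance : SymmetricCategory (OB k δ) where
  braiding X Y := permIso (upComm X.word Y.word) (dnComm X.word Y.word)
  braiding_naturality_right X _ _ f := OBHom.braid_naturality δ (𝟙 X : X ⟶ X) f
  braiding_naturality_left f Z := OBHom.braid_naturality δ f (𝟙 Z : Z ⟶ Z)
  hexagon_forward X Y Z := OBHom.hexagon_forward δ X.word Y.word Z.word
  hexagon_reverse X Y Z := OBHom.hexagon_reverse δ X.word Y.word Z.word
  symmetry X Y := OBHom.braid_braid δ X.word Y.word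

noncomputable instance : MonoidalPreadditive (OB k δ) where
  whiskerLeft_zero := OBHom.tensor_zero _
  zero_whiskerRight := OBHom.zero_tensor _
  whiskerLeft_add f g := OBHom.tensor_add _ f g
  add_whiskerRight f g := OBHom.add_tensor f g _

noncomputable instance : MonoidalLinear k (OB k δ) where
  whiskerLeft_smul _ _ _ r f := OBHom.tensor_smul _ r f
  smul_whiskerRight r _ _ f _ := OBHom.smul_tensor r f _

end OB

namespace OBWord
/-- The dual word: every letter is replaced by its dual. -/
def dualWord : OBWord → OBWord
  | one => one
  | gen => dual
  | dual => gen
  | tensor X Y => tensor (dualWord X) (dualWord Y)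

def upDual : ∀ X : OBWord, Up (dualWord X) ≃ Dn X
  | one => Equiv.refl Empty
  | gen => Equiv.refl Empty
  | dual => Equiv.refl Unit
  | tensor X Y => Equiv.sumCongr (upDual X) (upDual Y)

def dnDual : ∀ X : OBWord, Dn (dualWord X) ≃ Up X
  | one => Equiv.refl Empty
  | gen => Equiv.refl Unit
  | dual => Equiv.refl Empty
  | tensor X Y => Equiv.sumCongr (dnDual X) (dnDual Y)
end OBWord

namespace OBDiagram
variable {X Y Z W X' Y' Z' : OBWord}

def coev (X : OBWord) : OBDiagram one (X.tensor X.dualWord) :=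
  (Equiv.emptySum Empty (Dn X ⊕ Dn X.dualWord)).trans ((Equiv.sumComm _ _).trans
    (((dnDual X).sumCongr (upDual X).symm).trans (Equiv.sumEmpty (Up X ⊕ Up X.dualWord) Empty).symm))

def ev (X : OBWord) : OBDiagram (X.dualWord.tensor X) one :=
  (Equiv.sumEmpty (Up X.dualWord ⊕ Up X) Empty).trans ((Equiv.sumComm _ _).trans
    (((dnDual X).symm.sumCongr (upDual X)).trans (Equiv.emptySum Empty (Dn X.dualWord ⊕ Dn X)).symm))

def flip {C : Type} (c : Col C X) : Col C X.dualWord := ⟨c.2 ∘ upDual X, c.1 ∘ dnDual X⟩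

def flip' {C : Type} (c : Col C X.dualWord) : Col C X := ⟨c.2 ∘ (dnDual X).symm, c.1 ∘ (upDual X).symm⟩

theorem flip_eq {C : Type} (c : Col C X) (d : Col C X.dualWord) : d = flip c ↔ c = flip' d := by
  constructor
  · rintro rfl; ext <;> simp [flip, flip']
  · rintro rfl; ext <;> simp [flip, flip']

theorem compat_coev {C : Type} {a : Col C one} {b : Col C (X.tensor X.dualWord)} :
    Compat (coev X) a b ↔ (colTensor C _ _ b).2 = flip (colTensor C _ _ b).1 := by
  constructor
  · intro h
    apply Prod.ext
    · funext y
      have h1 : (colTensor C _ _ b).1.2 (upDual X y) =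
          (colTensor C _ _ b).2.1 ((upDual X).symm (upDual X y)) := h (.inr (.inl (upDual X y)))
      rw [Equiv.symm_apply_apply] at h1
      exact h1.symm
    · funext y
      exact h (.inr (.inr y))
  · intro h s
    rcases s with s | s | s
    · exact s.elim
    · have h1 : _ = (colTensor C _ _ b).1.2 (upDual X ((upDual X).symm s)) :=
        congrFun (congrArg Prod.fst h) ((upDual X).symm s)
      rw [Equiv.apply_symm_apply] at h1
      exact h1.symm
    · exact congrFun (congrArg Prod.snd h) s

theorem compat_ev {C : Type} {b : Col C one} {a : Col C (X.dualWord.tensor X)} :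
    Compat (ev X) a b ↔ (colTensor C _ _ a).1 = flip (colTensor C _ _ a).2 := by
  constructor
  · intro h
    apply Prod.ext
    · funext y
      exact h (.inl (.inl y))
    · funext y
      have h1 : (colTensor C _ _ a).2.1 (dnDual X y) =
          (colTensor C _ _ a).1.2 ((dnDual X).symm (dnDual X y)) := h (.inl (.inr (dnDual X y)))
      rw [Equiv.symm_apply_apply] at h1
      exact h1.symm
  · intro h s
    rcases s with (s | s) | s
    · exact congrFun (congrArg Prod.fst h) s
    · have h1 : _ = (colTensor C _ _ a).2.1 (dnDual X ((dnDual X).symm s)) :=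
        congrFun (congrArg Prod.snd h) ((dnDual X).symm s)
      rw [Equiv.apply_symm_apply] at h1
      exact h1.symm
    · exact s.elim

theorem compat_id {C : Type} {a b : Col C X} :
    Compat (perm (Equiv.refl (Up X)) (Equiv.refl (Dn X))) a b ↔ b = a := by
  rw [compat_perm]; rfl

theorem col_one_eq {C : Type} (a b : Col C one) : a = b := by
  apply Prod.ext <;> funext x <;> exact x.elim

theorem zigzag₁ (X : OBWord) :
    comp (tensor (perm (Equiv.refl (Up X.dualWord)) (Equiv.refl (Dn X.dualWord))) (coev X))
      (comp (perm (upAssoc _ _ _).symm (dnAssoc _ _ _).symm)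
        (tensor (ev X) (perm (Equiv.refl (Up X.dualWord)) (Equiv.refl (Dn X.dualWord))))) =
      perm ((upTensorOne X.dualWord).trans (upOneTensor X.dualWord).symm)
        ((dnTensorOne X.dualWord).trans (dnOneTensor X.dualWord).symm) ∧
    loops (tensor (perm (Equiv.refl (Up X.dualWord)) (Equiv.refl (Dn X.dualWord))) (coev X))
      (comp (perm (upAssoc _ _ _).symm (dnAssoc _ _ _).symm)
        (tensor (ev X) (perm (Equiv.refl (Up X.dualWord)) (Equiv.refl (Dn X.dualWord))))) = 0 := by
  classical
  apply comp_unique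
  intro c e
  rw [← card_eq_and ((colTensor Bool _ _).symm ⟨(colTensor Bool _ _ c).1,
    (colTensor Bool _ _).symm ⟨flip' (colTensor Bool _ _ c).1, (colTensor Bool _ _ c).1⟩⟩)
    (fun _ => Compat (perm ((upTensorOne X.dualWord).trans (upOneTensor X.dualWord).symm)
        ((dnTensorOne X.dualWord).trans (dnOneTensor X.dualWord).symm)) c e)]
  refine Nat.card_congr (Equiv.subtypeEquivRight fun d => ?_)
  have hP : Compat (perm ((upTensorOne X.dualWord).trans (upOneTensor X.dualWord).symm)
        ((dnTensorOne X.dualWord).trans (dnOneTensor X.dualWord).symm)) c e ↔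
        (colTensor Bool _ _ e).2 = (colTensor Bool _ _ c).1 := by
    rw [compat_perm, ← (colTensor Bool _ _).injective.eq_iff, Prod.ext_iff]
    exact ⟨fun h => h.2, fun h => ⟨col_one_eq _ _, h⟩⟩
  obtain ⟨⟨d1, d'⟩, rfl⟩ := (colTensor Bool _ _).symm.surjective d
  obtain ⟨⟨d2, d3⟩, rfl⟩ := (colTensor Bool _ _).symm.surjective d'
  rw [hP, (colTensor Bool _ _).symm.injective.eq_iff, Prod.mk.injEq,
    (colTensor Bool _ _).symm.injective.eq_iff, Prod.mk.injEq d2 d3]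
  rw [compat_perm_comp, compat_tensor, compat_tensor, compat_id, compat_id, compat_coev, compat_ev]
  change (d1 = _ ∧ d3 = flip d2) ∧ d1 = flip d2 ∧ _ = d3 ↔ _
  constructor
  · rintro ⟨⟨rfl, h1⟩, h2, h3⟩
    exact ⟨⟨rfl, (flip_eq _ _).1 h2, h1.trans h2.symm⟩, h3.trans (h1.trans h2.symm)⟩
  · rintro ⟨⟨rfl, h1, h2⟩, h3⟩
    have := (flip_eq _ _).2 h1
    exact ⟨⟨rfl, h2.trans this⟩, this, h3.trans h2.symm⟩

theorem zigzag₂ (X : OBWord) :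
    comp (tensor (coev X) (perm (Equiv.refl (Up X)) (Equiv.refl (Dn X))))
      (comp (perm (upAssoc _ _ _) (dnAssoc _ _ _))
        (tensor (perm (Equiv.refl (Up X)) (Equiv.refl (Dn X))) (ev X))) =
      perm ((upOneTensor X).trans (upTensorOne X).symm)
        ((dnOneTensor X).trans (dnTensorOne X).symm) ∧
    loops (tensor (coev X) (perm (Equiv.refl (Up X)) (Equiv.refl (Dn X))))
      (comp (perm (upAssoc _ _ _) (dnAssoc _ _ _))
        (tensor (perm (Equiv.refl (Up X)) (Equiv.refl (Dn X))) (ev X))) = 0 := by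
  classical
  apply comp_unique
  intro c e
  rw [← card_eq_and ((colTensor Bool _ _).symm ⟨(colTensor Bool _ _).symm
    ⟨(colTensor Bool _ _ c).2, flip (colTensor Bool _ _ c).2⟩, (colTensor Bool _ _ c).2⟩)
    (fun _ => Compat (perm ((upOneTensor X).trans (upTensorOne X).symm)
        ((dnOneTensor X).trans (dnTensorOne X).symm)) c e)]
  refine Nat.card_congr (Equiv.subtypeEquivRight fun d => ?_)
  have hP : Compat (perm ((upOneTensor X).trans (upTensorOne X).symm)
        ((dnOneTensor X).trans (dnTensorOne X).symm)) c e ↔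
        (colTensor Bool _ _ e).1 = (colTensor Bool _ _ c).2 := by
    rw [compat_perm, ← (colTensor Bool _ _).injective.eq_iff, Prod.ext_iff]
    exact ⟨fun h => h.1, fun h => ⟨h, col_one_eq _ _⟩⟩
  obtain ⟨⟨d', d3⟩, rfl⟩ := (colTensor Bool _ _).symm.surjective d
  obtain ⟨⟨d1, d2⟩, rfl⟩ := (colTensor Bool _ _).symm.surjective d'
  rw [hP, (colTensor Bool _ _).symm.injective.eq_iff, Prod.mk.injEq,
    (colTensor Bool _ _).symm.injective.eq_iff, Prod.mk.injEq]
  rw [compat_perm_comp, compat_tensor, compat_tensor, compat_id, compat_id, compat_coev, compat_ev]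
  change (d2 = flip d1 ∧ d3 = _) ∧ _ = d1 ∧ d2 = flip d3 ↔ _
  constructor
  · rintro ⟨⟨h1, rfl⟩, h2, h3⟩
    have h4 := (flip_eq _ _).1 h1
    have h5 := (flip_eq _ _).1 h3
    exact ⟨⟨⟨h4.trans h5.symm, h3⟩, rfl⟩, h2.trans (h4.trans h5.symm)⟩
  · rintro ⟨⟨⟨h1, h2⟩, h3⟩, h4⟩
    subst h1 h3
    exact ⟨⟨h2, rfl⟩, h4, h2⟩

theorem closed_loop : comp (comp (coev gen) (perm (upComm gen gen.dualWord) (dnComm gen gen.dualWord))) (ev gen) =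
      perm (Equiv.refl _) (Equiv.refl _) ∧
    loops (comp (coev gen) (perm (upComm gen gen.dualWord) (dnComm gen gen.dualWord))) (ev gen) = 1 := by
  classical
  apply comp_unique
  intro c e
  rw [if_pos (compat_id.2 (col_one_eq _ _)), pow_one]
  have h : ∀ d : Col Bool (gen.dualWord.tensor gen), Compat (comp (coev gen)
      (perm (upComm gen gen.dualWord) (dnComm gen gen.dualWord))) c d ∧ Compat (ev gen) d e ↔
      (colTensor Bool _ _ d).1 = flip (X := gen) (colTensor Bool _ _ d).2 := by
    intro d
    refine Iff.trans (and_congr (compat_comp_perm.trans compat_coev) compat_ev) ?_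
    exact and_iff_left_of_imp fun h => h
  have eq : {d : Col Bool (gen.dualWord.tensor gen) // Compat (comp (coev gen)
      (perm (upComm gen gen.dualWord) (dnComm gen gen.dualWord))) c d ∧ Compat (ev gen) d e} ≃ Bool :=
    { toFun := fun d => d.1.1 (.inr ())
      invFun := fun b => ⟨(colTensor Bool _ _).symm ⟨flip (X := gen) ⟨fun _ => b, fun x => x.elim⟩,
        ⟨fun _ => b, fun x => x.elim⟩⟩, (h _).2 rfl⟩
      left_inv := by
        rintro ⟨d, hd⟩
        have hd := (h d).1 hd
        have h2 : (colTensor Bool gen.dualWord gen d).2 = ⟨fun _ => d.1 (.inr ()), fun x => x.elim⟩ :=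
          Prod.ext rfl (funext fun x => x.elim)
        apply Subtype.ext
        apply (colTensor Bool _ _).injective
        exact Prod.ext ((congrArg flip h2.symm).trans hd.symm) h2.symm
      right_inv := fun b => rfl }
  rw [Nat.card_congr eq]
  simp

end OBDiagram

namespace OBHom
variable {k : Type w} [Field k] (δ : k)

theorem zigzag₁ (X : OBWord) :
    comp δ (tensor (perm (Equiv.refl (Up X.dualWord)) (Equiv.refl (Dn X.dualWord)))
        (Finsupp.single (coev X) 1))
      (comp δ (perm (upAssoc _ _ _).symm (dnAssoc _ _ _).symm)
        (tensor (Finsupp.single (ev X) 1)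
          (perm (Equiv.refl (Up X.dualWord)) (Equiv.refl (Dn X.dualWord))))) =
    comp (k := k) δ (perm (upTensorOne X.dualWord) (dnTensorOne X.dualWord))
      (perm (upOneTensor X.dualWord).symm (dnOneTensor X.dualWord).symm) := by
  rw [perm_comp_perm, perm_def, perm_def, tensor_single, tensor_single, comp_single, comp_single,
    (OBDiagram.perm_comp _ _ _).2, (OBDiagram.zigzag₁ X).1, (OBDiagram.zigzag₁ X).2, perm_def]
  simp

theorem zigzag₂ (X : OBWord) :
    comp δ (tensor (Finsupp.single (coev X) 1) (perm (Equiv.refl (Up X)) (Equiv.refl (Dn X))))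
      (comp δ (perm (upAssoc _ _ _) (dnAssoc _ _ _))
        (tensor (perm (Equiv.refl (Up X)) (Equiv.refl (Dn X))) (Finsupp.single (ev X) 1))) =
    comp (k := k) δ (perm (upOneTensor X) (dnOneTensor X))
      (perm (upTensorOne X).symm (dnTensorOne X).symm) := by
  rw [perm_comp_perm, perm_def, perm_def, tensor_single, tensor_single, comp_single, comp_single,
    (OBDiagram.perm_comp _ _ _).2, (OBDiagram.zigzag₂ X).1, (OBDiagram.zigzag₂ X).2, perm_def]
  simp

theorem closed_loop :
    comp δ (Finsupp.single (coev gen) 1)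
      (comp δ (perm (upComm gen gen.dualWord) (dnComm gen gen.dualWord))
        (Finsupp.single (ev gen) 1)) = δ • perm (Equiv.refl (Up one)) (Equiv.refl (Dn one)) := by
  rw [← assoc, perm_def, comp_single, (OBDiagram.comp_perm _ _ _).2, comp_single,
    OBDiagram.closed_loop.1, OBDiagram.closed_loop.2, perm_def]
  simp

end OBHom

namespace OB
variable {k : Type w} [Field k] {δ : k}

noncomputable instance exactPairing (X : OB k δ) : ExactPairing X (⟨X.word.dualWord⟩ : OB k δ) where
  coevaluation' := (Finsupp.single (coev X.word) 1 : OBHom k _ _)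
  evaluation' := (Finsupp.single (ev X.word) 1 : OBHom k _ _)
  coevaluation_evaluation' := OBHom.zigzag₁ δ X.word
  evaluation_coevaluation' := OBHom.zigzag₂ δ X.word

noncomputable instance : RigidCategory (OB k δ) where
  rightDual X := { rightDual := ⟨X.word.dualWord⟩ }
  leftDual X :=
    { leftDual := ⟨X.word.dualWord⟩
      exact := BraidedCategory.exactPairing_swap _ _ }

theorem diagram_one_eq (f : OBDiagram one one) : f = Equiv.refl _ := by
  ext s
  rcases s with s | s <;> exact s.elim

theorem algebraMap_eq (a : k) : algebraMap k (End (𝟙_ (OB k δ))) a =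
    (Finsupp.single (Equiv.refl _) a : OBHom k one one) := by
  rw [Algebra.algebraMap_eq_smul_one]
  change a • (Finsupp.single (Equiv.sumCongr _ _) 1 : OBHom k one one) = _
  rw [Finsupp.smul_single, smul_eq_mul, mul_one]
  congr 1
  exact diagram_one_eq _

instance : IsRSMCategory k (OB k δ) where
  bijective_algebraMap := by
    constructor
    · intro a b hab
      rw [algebraMap_eq, algebraMap_eq] at hab
      exact Finsupp.single_injective _ hab
    · intro f
      have e : ∀ f : OBHom k one one, Finsupp.single (Equiv.refl _) (f (Equiv.refl _)) = f := by
        intro f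
        ext g
        rw [diagram_one_eq g, Finsupp.single_eq_same]
      refine ⟨(show OBHom k one one from f) (Equiv.refl _), ?_⟩
      rw [algebraMap_eq]
      exact e f

/-- The generating object `V_δ`. -/
def V (k : Type w) [Field k] (δ : k) : OB k δ := ⟨gen⟩

theorem categoricalDim_V : categoricalDim k (V k δ) = δ := by
  rw [categoricalDim, Equiv.symm_apply_eq, Equiv.ofBijective_apply,
    Algebra.algebraMap_eq_smul_one]
  exact OBHom.closed_loop δ

end OB

/-! ### Jucys–Murphy elements in characteristic `p` -/

/-! Both statements rest on the partial trace over the first tensor factor, which turns an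
endomorphism of `X^{⊗ (n + 1)}` into one of `X^{⊗ n}`. Write `δ` for the dimension of `X`. Every
permutation of `n + 1` points is uniquely `(0 q) g` with `g` fixing `0`. Closing the first strand of
`(0 q) g` gives `g` if `q ≠ 0`, and `δ g` if `q = 0`, because then a loop splits off. Hence the
trace of the action of `x` is the action of the part of `(δ + L) x` supported on the stabiliser of
`0`, where `L = ∑ (0 i)` is a Jucys–Murphy element (`partialTrace_braidingMorphism`).

For the skew symmetriser this gives `(δ - n) a_n` as the trace of `a_{n+1}`
(`traceElement_skewSymmetriser`). Once some `a_n` acts by zero, so do all later ones, and `a_0` acts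
as a non-zero scalar. So there is a last `m` with `a_m ≠ 0` on `X`, and tracing `a_{m+1} = 0` yields
`(δ - m) a_m = 0`, that is `δ = m`.

For tensor ideals in characteristic `p`, the point is that all eigenvalues of `L` lie in the prime
field, in the form that `L ^ p - L` is nilpotent (`isNilpotent_jucysMurphy_pow_sub_self`). If `δ` is
outside the prime field, then `δ + L` is invertible. An ideal containing the action of some `x ≠ 0`
then contains that of `(δ + L)⁻¹ x g⁻¹`, whose trace is the restriction of `x g⁻¹` to the stabiliser
of `0`; this is non-zero when `g` is in the support of `x`. Repeating the step leads to `n = 0`, so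
the identity of the unit object is in the ideal and the ideal is everything
(`TensorIdeal.id_unit_mem`).

In the oriented Brauer category every non-zero ideal provides such an `x`: duality moves all dual
letters to the other side, producing a non-zero endomorphism of some `V^{⊗ n}`
(`OB.exists_ne_zero_tensorPow`), and all these endomorphisms come from the group algebra
(`OB.braidingMorphism_surjective`). -/

section JucysMurphy

/-- The relations of a degenerate affine Hecke algebra propagate the condition that the
eigenvalues lie in the prime field. -/
theorem isNilpotent_pow_sub_self_of_hecke {R : Type*} [Ring R] {p : ℕ} [Fact p.Prime] [CharP R p]
    {a b s : R} (hab : a * b = b * a) (hs : s * s = 1) (hsb : s * b = a * s + 1)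
    (ha : IsNilpotent (a ^ p - a)) : IsNilpotent (b ^ p - b) := by
  -- Multiplying `hsb` by `s` on both sides exchanges the roles of `a` and `b`.
  have hsa : s * a = b * s - 1 := by
    have h : s * (s * b) * s = s * (a * s + 1) * s := by rw [hsb]
    have h1 : s * (s * b) * s = b * s := by rw [← mul_assoc, hs, one_mul]
    have h2 : s * (a * s + 1) * s = s * a + 1 := by
      rw [mul_add, add_mul, mul_one, hs, mul_assoc, mul_assoc, hs, mul_one]
    rw [← h1, h, h2, add_sub_cancel_right]
  -- The intertwiner of the Hecke relations: it carries `b` to `a` and `a` to `b`, and its square is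
  -- a polynomial in `a - b`.
  obtain ⟨φ, hφ⟩ : ∃ φ, φ = s * (a - b) + 1 := ⟨_, rfl⟩
  have hφb : SemiconjBy φ b a := by
    change φ * b = a * φ
    rw [hφ]
    calc (s * (a - b) + 1) * b = s * (a * b - b * b) + b := by noncomm_ring
      _ = (s * b) * (a - b) + b := by rw [hab]; noncomm_ring
      _ = _ := by rw [hsb]; noncomm_ring
  have hφa : φ * a = b * φ := by
    rw [hφ]
    calc (s * (a - b) + 1) * a = s * (a * a - b * a) + a := by noncomm_ring
      _ = (s * a) * (a - b) + a := by rw [← hab]; noncomm_ring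
      _ = _ := by rw [hsa]; noncomm_ring
  have hsq : φ * φ = 1 - (a - b) ^ 2 := by
    have h1 : (a - b) * φ = φ * (b - a) := by rw [sub_mul, mul_sub, hφa, hφb.eq]
    calc φ * φ = s * ((a - b) * φ) + φ := by rw [← mul_assoc]; nth_rw 1 [hφ]; noncomm_ring
      _ = s * φ * (b - a) + φ := by rw [h1, mul_assoc]
      _ = (s * s * (a - b) + s) * (b - a) + φ := by nth_rw 1 [hφ]; noncomm_ring
      _ = _ := by rw [hs, hφ]; noncomm_ring
  obtain ⟨M, hM⟩ := ha
  have hc : Commute a b := hab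
  have hA : Commute (a ^ p - a) (b ^ p - b) :=
    ((hc.pow_pow p p).sub_right (hc.pow_left p)).sub_left ((hc.pow_right p).sub_right hc)
  -- Moving `(b ^ p - b) ^ M` through one factor of `φ * φ` turns it into `(a ^ p - a) ^ M`, which
  -- is zero.
  have h0 : (1 - (a - b) ^ 2) * (b ^ p - b) ^ M = 0 := by
    have h : SemiconjBy φ ((b ^ p - b) ^ M) ((a ^ p - a) ^ M) :=
      ((hφb.pow_right p).sub_right hφb).pow_right M
    rw [← hsq, mul_assoc, h.eq, hM, zero_mul, mul_zero]
  have h1 : ((a - b) ^ p - (a - b)) ^ 2 * (b ^ p - b) ^ M = 0 := by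
    -- Both `1` and `-1` are roots of `X ^ p - X`. The square gives each root its own copy, which is
    -- needed for `p = 2`, where they coincide.
    have hdvd : (1 - Polynomial.X ^ 2 : Polynomial (ZMod p)) ∣
        (Polynomial.X ^ p - Polynomial.X) ^ 2 := by
      have e : (1 - Polynomial.X ^ 2 : Polynomial (ZMod p)) =
          -((Polynomial.X - Polynomial.C 1) * (Polynomial.X - Polynomial.C (-1))) := by
        simp; ring
      rw [e, neg_dvd, sq]
      refine mul_dvd_mul ?_ ?_ <;> rw [Polynomial.dvd_iff_isRoot] <;> simp
    obtain ⟨q, hq⟩ := hdvd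
    let _ : Algebra (ZMod p) R := ZMod.algebra R p
    have h := congrArg (Polynomial.aeval (a - b)) ((mul_comm _ _).trans hq.symm).symm
    simp only [map_mul, map_pow, map_sub, map_one, Polynomial.aeval_X] at h
    rw [h, mul_assoc, h0, mul_zero]
  have h2 : (a - b) ^ p - (a - b) = (a ^ p - a) - (b ^ p - b) := by
    rw [sub_pow_char_of_commute _ hc]; abel
  rw [h2] at h1
  generalize a ^ p - a = A at *
  generalize b ^ p - b = B at *
  -- Since `(A - B) ^ 2 * B ^ M = 0`, expanding the square leaves `B ^ (M + 2)` equal to terms with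
  -- a factor `A`, which is nilpotent and commutes with `B`.
  have h3 : B ^ (M + 2) = A * ((2 * B - A) * B ^ M) := by
    have h4 : (A - B) ^ 2 * B ^ M = B ^ (M + 2) - A * ((2 * B - A) * B ^ M) := by
      calc (A - B) ^ 2 * B ^ M = (A * A - A * B - B * A + B * B) * B ^ M := by noncomm_ring
        _ = B * B * B ^ M - A * ((2 * B - A) * B ^ M) := by rw [← hA.eq]; noncomm_ring
        _ = _ := by rw [add_comm M 2, pow_add, sq]
    rw [h4] at h1
    exact sub_eq_zero.1 h1
  have hA' : Commute A ((2 * B - A) * B ^ M) :=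
    (((Nat.commute_cast A 2).mul_right hA).sub_right (Commute.refl A)).mul_right (hA.pow_right M)
  have h5 : IsNilpotent (B ^ (M + 2)) := by
    rw [h3]
    exact hA'.isNilpotent_mul_right ⟨M, hM⟩
  exact h5.of_pow

/-! ### The stabiliser of `0` in the symmetric group and its cosets. -/

namespace Equiv.Perm

/-- The permutation of `Fin (n + 1)` which fixes `0` and acts by `g` on the other elements. -/
def shift (n : ℕ) : Perm (Fin n) →* Perm (Fin (n + 1)) where
  toFun g := decomposeFin.symm (0, g)
  map_one' := (decomposeFin_symm_of_one _).trans (swap_self _)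
  map_mul' g h := by
    ext i
    refine Fin.cases ?_ (fun i => ?_) i <;> simp

theorem shift_zero {n : ℕ} (g : Perm (Fin n)) : shift n g 0 = 0 := by simp [shift]

theorem shift_succ {n : ℕ} (g : Perm (Fin n)) (i : Fin n) : shift n g i.succ = (g i).succ := by
  simp [shift]

/-- The transpositions `swap 0 q`, together with the identity for `q = 0`, represent the left cosets
of the stabiliser of `0`. This product form is what the partial trace can evaluate. -/
theorem decomposeFin_symm_eq {n : ℕ} (q : Fin (n + 1)) (g : Perm (Fin n)) :
    decomposeFin.symm (q, g) = swap 0 q * shift n g := by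
  ext i
  refine Fin.cases ?_ (fun i => ?_) i <;> simp [shift_zero, shift_succ]

theorem shift_swap {n : ℕ} (i j : Fin n) : shift n (swap i j) = swap i.succ j.succ := by
  ext l
  refine Fin.cases ?_ (fun l => ?_) l
  · rw [shift_zero, swap_apply_of_ne_of_ne (Fin.succ_ne_zero i).symm (Fin.succ_ne_zero j).symm]
  · rw [shift_succ, (Fin.succ_injective n).swap_apply]

/-- Conjugation relabels the entries of a transposition, and `shift n g` fixes `0`. -/
theorem shift_mul_swap {n : ℕ} (g : Perm (Fin n)) (i : Fin n) :
    shift n g * swap 0 i.succ = swap 0 (g i).succ * shift n g := by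
  rw [mul_swap_eq_swap_mul, shift_zero, shift_succ]

end Equiv.Perm

open Equiv Equiv.Perm MonoidAlgebra

variable (k : Type w) [Field k]

/-- The Jucys–Murphy element `∑ (0 i)` in the group algebra of the symmetric group. -/
noncomputable def jucysMurphy (n : ℕ) : MonoidAlgebra k (Perm (Fin (n + 1))) :=
  ∑ i : Fin n, single (swap 0 i.succ) 1

theorem mapDomain_shift_jucysMurphy (n : ℕ) :
    mapDomainRingHom k (shift (n + 1)) (jucysMurphy k n) =
      ∑ i : Fin n, single (swap 1 i.succ.succ) 1 := by
  simp [jucysMurphy, shift_swap]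

/-- Conjugation by a permutation fixing `0` only permutes the summands `(0 i)`. -/
theorem commute_shift_jucysMurphy {n : ℕ} (g : Perm (Fin n)) :
    Commute (single (shift n g) (1 : k)) (jucysMurphy k n) := by
  change _ * _ = _ * _
  simp only [jucysMurphy, Finset.mul_sum, Finset.sum_mul, single_mul_single, mul_one,
    shift_mul_swap]
  exact Equiv.sum_comp g fun i => single (swap 0 i.succ * shift n g) (1 : k)

/-- Nilpotence of `L ^ p - L` says that the eigenvalues of `L` lie in the prime field, without any
representation theory. The induction adds one point at a time: consecutive Jucys–Murphy elements and
a transposition satisfy the Hecke relations. -/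
theorem isNilpotent_jucysMurphy_pow_sub_self (p : ℕ) [Fact p.Prime] [CharP k p] (n : ℕ) :
    IsNilpotent (jucysMurphy k n ^ p - jucysMurphy k n) := by
  induction n with
  | zero => simp [jucysMurphy, (Fact.out : p.Prime).ne_zero]
  | succ n ih =>
    have : CharP (MonoidAlgebra k (Perm (Fin (n + 2)))) p :=
      charP_of_injective_algebraMap (algebraMap k _).injective p
    have ha := ih.map (mapDomainRingHom k (shift (n + 1)))
    rw [map_sub, map_pow] at ha
    -- Here `a` is the Jucys–Murphy element of the points other than `0`, the sum of the `(1 j)`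
    -- with `j ≥ 2`, and `b` is the one of all points, the sum of the `(0 j)` with `j ≥ 1`.
    refine isNilpotent_pow_sub_self_of_hecke (s := single (swap 0 1) 1) ?_ ?_ ?_ ha
    · rw [mapDomain_shift_jucysMurphy]
      refine (Commute.sum_left _ _ _ fun i _ => ?_).eq
      rw [← Fin.succ_zero_eq_one, ← shift_swap]
      exact commute_shift_jucysMurphy k _
    · rw [single_mul_single, swap_mul_self, one_mul, MonoidAlgebra.one_def]
    -- The summand `(0 1)` of `b` is split off, because `s * (0 1) = 1` is the constant term of the
    -- Hecke relation. For the others, `(0 1)(0 j) = (1 j)(0 1)`.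
    · rw [mapDomain_shift_jucysMurphy, jucysMurphy, Fin.sum_univ_succ, mul_add,
        Finset.mul_sum, Finset.sum_mul, add_comm (_ * _)]
      simp only [single_mul_single, mul_one, Fin.succ_zero_eq_one, swap_mul_self, ← MonoidAlgebra.one_def]
      congr 1
      refine Finset.sum_congr rfl fun i _ => ?_
      rw [mul_swap_eq_swap_mul, swap_apply_left, swap_apply_of_ne_of_ne]
      · exact Fin.succ_ne_zero _
      · exact fun h => Fin.succ_ne_zero i (Fin.succ_injective _ h)

/-- For `y = δ + L`, additivity of the Frobenius on commuting elements gives `y ^ p - y = (δ ^ p -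
δ) + (L ^ p - L)`, a non-zero scalar plus a nilpotent element. This is a unit, and `y` divides it.
-/
theorem isUnit_algebraMap_add_jucysMurphy (p : ℕ) [Fact p.Prime] [CharP k p] (n : ℕ) {δ : k}
    (hδ : δ ∉ (ZMod.castHom (dvd_refl p) k).range) :
    IsUnit (algebraMap k _ δ + jucysMurphy k n) := by
  have : CharP (MonoidAlgebra k (Perm (Fin (n + 1)))) p :=
    charP_of_injective_algebraMap (algebraMap k _).injective p
  -- The prime field consists of the fixed points of the Frobenius.
  have h1 : δ ^ p - δ ≠ 0 := by
    intro h
    let _ : Algebra (ZMod p) k := ZMod.algebra k p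
    have h2 := (Subfield.mem_bot_iff_pow_eq_self k p).2 (sub_eq_zero.1 h)
    rw [← ZMod.fieldRange_castHom_eq_bot p] at h2
    exact hδ h2
  have hc : Commute (algebraMap k _ δ) (jucysMurphy k n) := Algebra.commutes _ _
  have h2 : IsUnit ((algebraMap k _ δ + jucysMurphy k n) ^ p -
      (algebraMap k _ δ + jucysMurphy k n)) := by
    rw [add_pow_char_of_commute _ hc, add_sub_add_comm, ← map_pow, ← map_sub]
    exact (isNilpotent_jucysMurphy_pow_sub_self k p n).isUnit_add_left_of_commute
      ((isUnit_iff_ne_zero.2 h1).map _) (Algebra.commutes _ _).symm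
  -- With `p = m + 1`, the unit factors as `x * (x ^ m - 1)` into commuting factors.
  obtain ⟨m, rfl⟩ := Nat.exists_eq_add_one_of_ne_zero (Fact.out : p.Prime).ne_zero
  generalize algebraMap k _ δ + jucysMurphy k n = x at h2
  rw [pow_succ', ← mul_sub_one] at h2
  exact ((((Commute.refl x).pow_right m).sub_right (Commute.one_right x)).isUnit_mul_iff.1 h2).1

end JucysMurphy

/-! ### The partial trace -/

section GroupAlgebra

open Equiv Equiv.Perm MonoidAlgebra

variable (k : Type w) [Field k]

/-- The element of the group algebra of `S_n` through which the partial trace of the action of `x`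
on `X^{⊗ (n + 1)}` acts, where `δ` is the dimension of `X`. -/
noncomputable def traceElement {n : ℕ} (δ : k) (x : MonoidAlgebra k (Perm (Fin (n + 1)))) :
    MonoidAlgebra k (Perm (Fin n)) :=
  ∑ g, single g (((algebraMap k _ δ + jucysMurphy k n) * x).coeff (shift n g))

/-- Each `swap 0 q` is its own inverse, so multiplication by it shifts coefficients by `swap 0 q`.
The index `q = 0` stands for the identity and carries the scalar `δ`. -/
theorem coeff_jucysMurphy_add_mul {n : ℕ} (δ : k) (x : MonoidAlgebra k (Perm (Fin (n + 1))))
    (g : Perm (Fin (n + 1))) :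
    ((algebraMap k _ δ + jucysMurphy k n) * x).coeff g =
      ∑ q, (if q = 0 then δ else 1) * x.coeff (swap 0 q * g) := by
  rw [Fin.sum_univ_succ, add_mul, ← Algebra.smul_def, jucysMurphy, Finset.sum_mul]
  simp [Fin.succ_ne_zero, MonoidAlgebra.coeff_single_mul_apply, swap_self, ← Perm.one_def]

theorem eq_sum_single {n : ℕ} (x : MonoidAlgebra k (Perm (Fin n))) :
    x = ∑ g, single g (x.coeff g) := by
  ext g
  simp

theorem sum_perm_succ {M : Type*} [AddCommMonoid M] {n : ℕ} (f : Perm (Fin (n + 1)) → M) :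
    ∑ g, f g = ∑ g : Perm (Fin n), ∑ q : Fin (n + 1), f (swap 0 q * shift n g) := by
  rw [← decomposeFin.symm.sum_comp, Fintype.sum_prod_type, Finset.sum_comm]
  simp only [decomposeFin_symm_eq]

theorem sign_swap_mul_shift (n : ℕ) (q : Fin (n + 1)) (g : Equiv.Perm (Fin n)) :
    Equiv.Perm.sign (Equiv.swap 0 q * shift n g) =
      (if q = 0 then 1 else -1) * Equiv.Perm.sign g := by
  rw [← decomposeFin_symm_eq, Equiv.Perm.decomposeFin.symm_sign]

theorem coeff_skewSymmetriser (n : ℕ) (g : Equiv.Perm (Fin n)) :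
    (skewSymmetriser k n).coeff g = ((Equiv.Perm.sign g : ℤ) : k) := by
  simp [skewSymmetriser, Finsupp.single_apply]

/-- The identity coset contributes `δ`, and each of the `n` transpositions `(0 q)` contributes `-1`
because it reverses the sign. -/
theorem traceElement_skewSymmetriser (n : ℕ) (δ : k) :
    traceElement k δ (skewSymmetriser k (n + 1)) = (δ - n) • skewSymmetriser k n := by
  rw [traceElement, skewSymmetriser.eq_1 k n, Finset.smul_sum]
  refine Finset.sum_congr rfl fun g _ => ?_
  rw [coeff_jucysMurphy_add_mul, MonoidAlgebra.smul_single, Fin.sum_univ_succ]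
  simp only [coeff_skewSymmetriser, sign_swap_mul_shift]
  congr 1
  simp [Fin.succ_ne_zero]
  ring

variable {A : Type u} [Category.{v} A] [MonoidalCategory A] [SymmetricCategory A]

theorem permHom_shift (X : A) (n : ℕ) (g : Equiv.Perm (Fin n)) :
    permHom X (n + 1) (shift n g) = X ◁ permHom X n g := by
  have h : permTail (shift n g) = g := permTail_eq _ _ fun j => by
    rw [shift_zero, shift_succ, Fin.succAbove_zero]
  rw [permHom_succ, h, shift_zero]
  exact (congrArg _ (moveHead_zero X n n.succ_pos)).trans (Category.comp_id _)

variable [Preadditive A] [Linear k A]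

theorem braidingMorphism_single (X : A) (n : ℕ) (g : Equiv.Perm (Fin n))
    (a : k) : braidingMorphism k X n (single g a) = a • permHom X n g := by
  simp [braidingMorphism, permAction]

theorem braidingMorphism_apply (X : A) (n : ℕ) (x : MonoidAlgebra k (Perm (Fin n))) :
    braidingMorphism k X n x = ∑ g, x.coeff g • permHom X n g := by
  conv_lhs => rw [eq_sum_single k x, map_sum]
  exact Finset.sum_congr rfl fun g _ => braidingMorphism_single k X n g _

/-- Summing over cosets writes `a_{n+1}` as `∑ ± (0 q) · shift a_n`, and every summand acts through
`X ◁ a_n`. -/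
theorem braidingMorphism_skewSymmetriser_succ [MonoidalPreadditive A] [MonoidalLinear k A]
    (X : A) (n : ℕ)
    (h : braidingMorphism k X n (skewSymmetriser k n) = 0) :
    braidingMorphism k X (n + 1) (skewSymmetriser k (n + 1)) = 0 := by
  rw [braidingMorphism_apply] at h
  rw [braidingMorphism_apply, sum_perm_succ, Finset.sum_comm]
  refine Finset.sum_eq_zero fun q _ => ?_
  have h1 : ∀ g, (skewSymmetriser k (n + 1)).coeff (Equiv.swap 0 q * shift n g) •
      permHom X (n + 1) (Equiv.swap 0 q * shift n g) =
      (if q = 0 then 1 else -1 : k) • (X ◁ ((skewSymmetriser k n).coeff g • permHom X n g)) ≫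
        permHom X (n + 1) (Equiv.swap 0 q) := by
    intro g
    rw [coeff_skewSymmetriser, coeff_skewSymmetriser, sign_swap_mul_shift, permHom_mul,
      permHom_shift, MonoidalLinear.whiskerLeft_smul, Linear.smul_comp, smul_smul]
    congr 1
    split_ifs <;> simp
  simp only [h1]
  rw [← Finset.smul_sum, ← Preadditive.sum_comp, ← whiskerLeft_sum, h]
  simp

end GroupAlgebra

/-! ### The partial trace over the first factor in a rigid symmetric category. -/

section PartialTrace

open Equiv.Perm

variable {A : Type u} [Category.{v} A] [MonoidalCategory A] [SymmetricCategory A] [RigidCategory A]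

/-- The partial trace of a morphism over its first tensor factor. -/
def partialTrace (X : A) {T T' : A} (f : X ⊗ T ⟶ X ⊗ T') : T ⟶ T' :=
  (λ_ T).inv ≫ (η_ X Xᘁ ≫ (β_ X Xᘁ).hom) ▷ T ≫ (α_ Xᘁ X T).hom ≫ Xᘁ ◁ f ≫
    (α_ Xᘁ X T').inv ≫ ε_ X Xᘁ ▷ T' ≫ (λ_ T').hom

/-- A morphism that does not touch the traced factor slides past the coevaluation by the interchange
law. With its mirror image below, this makes the trace a map of bimodules. -/
theorem partialTrace_whiskerLeft_comp (X : A) {S T T' : A} (h : S ⟶ T) (f : X ⊗ T ⟶ X ⊗ T') :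
    partialTrace X (X ◁ h ≫ f) = h ≫ partialTrace X f := by
  simp only [partialTrace, whiskerLeft_comp, Category.assoc, leftUnitor_inv_naturality_assoc,
    whisker_exchange_assoc, associator_naturality_right_assoc]

theorem partialTrace_comp_whiskerLeft (X : A) {T T' S : A} (f : X ⊗ T ⟶ X ⊗ T') (h : T' ⟶ S) :
    partialTrace X (f ≫ X ◁ h) = partialTrace X f ≫ h := by
  simp only [partialTrace, whiskerLeft_comp, Category.assoc, ← leftUnitor_naturality,
    ← whisker_exchange_assoc, associator_inv_naturality_right_assoc]

theorem partialTrace_id (X T : A) :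
    partialTrace X (𝟙 (X ⊗ T)) = (λ_ T).inv ≫ dimEnd X ▷ T ≫ (λ_ T).hom := by
  simp [partialTrace, dimEnd]

/-- Closing one strand of a crossing leaves a single strand with a kink, which straightens by a
zigzag identity. -/
theorem partialTrace_braiding (X : A) : partialTrace X (β_ X X).hom = 𝟙 X := by
  -- By the hexagon, the crossing is the braiding of the whole `Xᘁ ⊗ X` past `X`, with the
  -- superfluous crossing of `Xᘁ` undone by symmetry. Naturality then slides the coevaluation
  -- through.
  have h1 : Xᘁ ◁ (β_ X X).hom = (α_ Xᘁ X X).inv ≫ (β_ (Xᘁ ⊗ X) X).hom ≫ (α_ X Xᘁ X).inv ≫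
      (β_ X Xᘁ).hom ▷ X ≫ (α_ Xᘁ X X).hom := by
    simp [braiding_tensor_left_hom, ← comp_whiskerRight_assoc]
  -- The zigzag identity that remains is the one for the pairing with `X` and `Xᘁ` exchanged by the
  -- braiding.
  have h2 := (exactPairing_swap X Xᘁ).coevaluation_evaluation'
  change X ◁ (η_ X Xᘁ ≫ (β_ Xᘁ X).inv) ≫ _ ≫ ((β_ X Xᘁ).hom ≫ ε_ X Xᘁ) ▷ X = _ at h2
  rw [← SymmetricCategory.braiding_swap_eq_inv_braiding] at h2
  rw [partialTrace, h1]
  simp only [Category.assoc, Iso.hom_inv_id_assoc]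
  rw [braiding_naturality_left_assoc, ← comp_whiskerRight_assoc, reassoc_of% h2]
  simp

theorem partialTrace_whiskerRight (X : A) {T T' : A} (f : X ⊗ T ⟶ X ⊗ T') (S : A) :
    partialTrace X ((α_ X T S).inv ≫ f ▷ S ≫ (α_ X T' S).hom) = partialTrace X f ▷ S := by
  simp only [partialTrace]
  monoidal

theorem partialTrace_swapHead (X T : A) : partialTrace X (swapHead X T) = 𝟙 (X ⊗ T) := by
  rw [swapHead, partialTrace_whiskerRight, partialTrace_braiding, id_whiskerRight]

theorem partialTrace_permHom_swap (X : A) (n : ℕ) (q : Fin n) :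
    partialTrace X (permHom X (n + 1) (Equiv.swap 0 q.succ)) = 𝟙 (tensorPow X n) := by
  obtain ⟨n, rfl⟩ : ∃ m, n = m + 1 := ⟨n - 1, by have := q.pos; omega⟩
  -- Conjugation by a permutation fixing `0` reduces to the transposition of the first two factors.
  -- The conjugating involution leaves the trace on both sides and cancels.
  have h1 : Equiv.swap 0 q.succ = shift (n + 1) (Equiv.swap 0 q) * Equiv.swap 0 1 *
      shift (n + 1) (Equiv.swap 0 q) := by
    rw [← Fin.succ_zero_eq_one, shift_mul_swap, Equiv.swap_apply_left, mul_assoc, ← map_mul,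
      Equiv.swap_mul_self, map_one, mul_one]
  have h2 : permHom X (n + 2) (Equiv.swap 0 1) = swapHead X (tensorPow X n) :=
    permAction_swap X (n + 1) 0
  rw [h1, permHom_mul, permHom_mul, permHom_shift, h2, partialTrace_whiskerLeft_comp,
    partialTrace_comp_whiskerLeft]
  erw [partialTrace_swapHead]
  rw [Category.id_comp, ← permHom_mul, Equiv.swap_mul_self, permHom_one]

section Linear

variable (k : Type w) [Field k] [Preadditive A] [Linear k A]

/-- The partial trace only tensors with `Xᘁ` and composes with fixed morphisms. -/
theorem TensorIdeal.partialTrace_mem (I : TensorIdeal k A) (X : A) {T T' : A} (f : X ⊗ T ⟶ X ⊗ T')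
    (hf : f ∈ I.mor _ _) : partialTrace X f ∈ I.mor T T' :=
  I.precomp_mem _ _ <| I.precomp_mem _ _ <| I.precomp_mem _ _ <|
    I.comp_mem _ _ <| I.whiskerLeft_mem _ _ hf

variable [MonoidalPreadditive A] [MonoidalLinear k A]

/-- The partial trace as a linear map. -/
def partialTraceₗ (X T T' : A) : (X ⊗ T ⟶ X ⊗ T') →ₗ[k] (T ⟶ T') where
  toFun := partialTrace X
  map_add' f g := by simp [partialTrace]
  map_smul' a f := by simp [partialTrace]

variable [IsRSMCategory k A]

theorem dimEnd_eq (X : A) : dimEnd X = categoricalDim k X • 𝟙 (𝟙_ A) := by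
  have h := Equiv.ofBijective_apply_symm_apply _
    (IsRSMCategory.bijective_algebraMap (k := k) (A := A)) (dimEnd X)
  rw [Algebra.algebraMap_eq_smul_one] at h
  exact h.symm

theorem partialTrace_permHom (X : A) (n : ℕ) (q : Fin (n + 1)) (g : Equiv.Perm (Fin n)) :
    partialTrace X (permHom X (n + 1) (Equiv.swap 0 q * shift n g)) =
      (if q = 0 then categoricalDim k X else 1) • permHom X n g := by
  rw [permHom_mul, permHom_shift]
  refine (partialTrace_whiskerLeft_comp X _ _).trans ?_
  refine Fin.cases ?_ (fun q => ?_) q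
  · rw [Equiv.swap_self]
    have h : permHom X (n + 1) (Equiv.refl _) = 𝟙 (X ⊗ tensorPow X n) := permHom_one X (n + 1)
    rw [h, partialTrace_id, dimEnd_eq k]
    simp
  · rw [partialTrace_permHom_swap, Category.comp_id, if_neg (Fin.succ_ne_zero q), one_smul]

/-- By linearity it suffices to trace the products `swap 0 q * shift n g`. Collecting those with the
same `g` gives the weights `δ` for `q = 0` and `1` otherwise, which are the coefficients of `δ + L`.
-/
theorem partialTrace_braidingMorphism (X : A) (n : ℕ)
    (x : MonoidAlgebra k (Equiv.Perm (Fin (n + 1)))) :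
    partialTrace X (braidingMorphism k X (n + 1) x) =
      braidingMorphism k X n (traceElement k (categoricalDim k X) x) := by
  let L := partialTraceₗ k X (tensorPow X n) (tensorPow X n)
  change L _ = _
  rw [braidingMorphism_apply, sum_perm_succ, map_sum, traceElement, map_sum]
  refine Finset.sum_congr rfl fun g _ => ?_
  rw [braidingMorphism_single, coeff_jucysMurphy_add_mul, Finset.sum_smul, map_sum]
  refine Finset.sum_congr rfl fun q _ => ?_
  rw [map_smul]
  change _ • partialTrace X _ = _
  rw [partialTrace_permHom k, smul_smul, mul_comm]

theorem exists_isGreatest_skewSymmetriser (X : A)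
    (h : ∃ n, braidingMorphism k X n (skewSymmetriser k n) = 0) :
    ∃ m : ℕ, IsGreatest {n : ℕ | braidingMorphism k X n (skewSymmetriser k n) ≠ 0} m ∧
      categoricalDim k X = (m : k) := by
  classical
  -- `a_0` is the identity of the unit object, non-zero because `k → End(𝟙)` is injective. So the
  -- first vanishing index is some `m + 1`.
  have h0 : braidingMorphism k X 0 (skewSymmetriser k 0) ≠ 0 := by
    have h1 : skewSymmetriser k 0 = 1 := by
      simp [skewSymmetriser, MonoidAlgebra.one_def]
    rw [h1, map_one]
    intro h2
    refine one_ne_zero (α := k)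
      ((IsRSMCategory.bijective_algebraMap (k := k) (A := A)).injective ?_)
    rw [map_one, map_zero]
    exact h2
  obtain ⟨m, hm⟩ := Nat.exists_eq_add_one_of_ne_zero
    (fun hz => h0 (hz ▸ Nat.find_spec h) : Nat.find h ≠ 0)
  have hm1 : braidingMorphism k X m (skewSymmetriser k m) ≠ 0 := Nat.find_min h (by omega)
  have hz : ∀ n, m + 1 ≤ n → braidingMorphism k X n (skewSymmetriser k n) = 0 := fun n hn => by
    induction n, hn using Nat.le_induction with
    | base => exact hm ▸ Nat.find_spec h
    | succ n _ ih => exact braidingMorphism_skewSymmetriser_succ k X n ih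
  refine ⟨m, ⟨hm1, fun n hn => ?_⟩, ?_⟩
  · by_contra hlt
    exact hn (hz n (by omega))
  -- Tracing `a_{m+1} = 0` gives `(dim X - m) a_m = 0`, where `a_m` acts non-trivially.
  · have h1 := partialTrace_braidingMorphism k X m (skewSymmetriser k (m + 1))
    rw [hz _ le_rfl, traceElement_skewSymmetriser, map_smul] at h1
    have h2 : partialTrace X (0 : X ⊗ tensorPow X m ⟶ X ⊗ tensorPow X m) = 0 :=
      map_zero (partialTraceₗ k X _ _)
    exact sub_eq_zero.1 ((smul_eq_zero.1 (h1.symm.trans h2)).resolve_right hm1)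

/-! ### Tensor ideals and the group algebras of the symmetric groups -/

/-- Descent on `n`: the partial trace stays in the ideal, and invertibility of `δ + L` allows `x` to
be modified beforehand so that its trace does not vanish. -/
theorem TensorIdeal.id_unit_mem (I : TensorIdeal k A) (p : ℕ) [Fact p.Prime] [CharP k p] (X : A)
    (hX : categoricalDim k X ∉ (ZMod.castHom (dvd_refl p) k).range) (n : ℕ)
    (x : MonoidAlgebra k (Equiv.Perm (Fin n))) (hx : x ≠ 0)
    (hI : braidingMorphism k X n x ∈ I.mor _ _) : 𝟙 (𝟙_ A) ∈ I.mor _ _ := by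
  induction n with
  | zero =>
    -- `S_0` is trivial, so `x` is a non-zero scalar and can be divided out.
    obtain ⟨a, rfl⟩ : ∃ a, x = MonoidAlgebra.single 1 a := ⟨x.coeff 1, by
      refine MonoidAlgebra.ext (Finsupp.ext fun g => ?_)
      rw [Subsingleton.elim g 1]
      simp⟩
    rw [braidingMorphism_single] at hI
    have ha : a ≠ 0 := by
      rintro rfl
      simp at hx
    have h := (I.mor _ _).smul_mem a⁻¹ hI
    rwa [smul_smul, inv_mul_cancel₀ ha, one_smul] at h
  | succ n ih =>
    obtain ⟨⟨u, v, huv, -⟩, rfl : u = _⟩ := isUnit_algebraMap_add_jucysMurphy k p n hX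
    obtain ⟨g, hg⟩ : ∃ g, x.coeff g ≠ 0 := by
      by_contra! h
      exact hx (by ext g; simp [h])
    -- The inverse `v` cancels the factor `δ + L` in the trace, and `g⁻¹` moves a non-zero
    -- coefficient of `x` to the identity, which lies in the stabiliser of `0`.
    refine ih (traceElement k (categoricalDim k X) (v * x * MonoidAlgebra.single g⁻¹ 1)) ?_ ?_
    · intro h
      have h1 := congrArg (fun y => y.coeff 1) h
      rw [traceElement, mul_assoc v, ← mul_assoc _ v, huv, one_mul] at h1
      simp [Finsupp.single_apply] at h1
      exact hg h1
    · rw [← partialTrace_braidingMorphism]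
      refine I.partialTrace_mem k X _ ?_
      rw [map_mul, map_mul]
      exact I.precomp_mem _ _ (I.comp_mem _ _ hI)

end Linear

end PartialTrace

/-- Every morphism out of `X` factors through `𝟙 (𝟙_ A) ▷ X`, up to unitors. -/
theorem TensorIdeal.mem_of_id_unit_mem {k : Type w} [Field k] {A : Type u} [Category.{v} A]
    [Preadditive A] [Linear k A] [MonoidalCategory A] (I : TensorIdeal k A)
    (h : 𝟙 (𝟙_ A) ∈ I.mor _ _) {X Y : A} (f : X ⟶ Y) : f ∈ I.mor X Y := by
  have h1 : f = (λ_ X).inv ≫ 𝟙 (𝟙_ A) ▷ X ≫ (λ_ X).hom ≫ f := by simp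
  rw [h1]
  exact I.precomp_mem _ _ (I.comp_mem _ _ (I.whiskerRight_mem _ _ h))

/-! ### Transport of non-zero ideal elements along isomorphisms and duality. -/

namespace TensorIdeal

variable {k : Type w} [Field k] {A : Type u} [Category.{v} A] [Preadditive A] [Linear k A]
  [MonoidalCategory A] (I : TensorIdeal k A)

theorem exists_ne_zero_of_iso {X X' Y Y' : A} (e : X ≅ X') (e' : Y ≅ Y')
    (h : ∃ f ∈ I.mor X Y, f ≠ 0) : ∃ f ∈ I.mor X' Y', f ≠ 0 := by
  obtain ⟨f, hf, h0⟩ := h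
  refine ⟨e.inv ≫ f ≫ e'.hom, I.precomp_mem _ _ (I.comp_mem _ _ hf), fun h => h0 ?_⟩
  have h1 : f = e.hom ≫ (e.inv ≫ f ≫ e'.hom) ≫ e'.inv := by simp
  rw [h1, h]
  simp

/-- The duality bijection tensors with `Y'` and composes with the coevaluation, so it preserves the
ideal; being injective and sending `0` to `0`, it preserves non-vanishing. -/
theorem exists_ne_zero_of_tensorRight (X Y Y' Z : A) [ExactPairing Y Y'] [MonoidalPreadditive A]
    (h : ∃ f ∈ I.mor (X ⊗ Y) Z, f ≠ 0) : ∃ f ∈ I.mor X (Z ⊗ Y'), f ≠ 0 := by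
  obtain ⟨f, hf, h0⟩ := h
  refine ⟨tensorRightHomEquiv X Y Y' Z f, I.precomp_mem _ _ <| I.precomp_mem _ _ <|
    I.precomp_mem _ _ <| I.whiskerRight_mem _ _ hf, fun h => h0 ?_⟩
  have h1 : tensorRightHomEquiv X Y Y' Z 0 = 0 := by simp [tensorRightHomEquiv]
  exact (tensorRightHomEquiv X Y Y' Z).injective (h.trans h1.symm)

theorem exists_ne_zero_of_tensorRight_symm (X Y Y' Z : A) [ExactPairing Y Y']
    [MonoidalPreadditive A] (h : ∃ f ∈ I.mor X (Z ⊗ Y'), f ≠ 0) :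
    ∃ f ∈ I.mor (X ⊗ Y) Z, f ≠ 0 := by
  obtain ⟨f, hf, h0⟩ := h
  refine ⟨(tensorRightHomEquiv X Y Y' Z).symm f, I.comp_mem _ _ (I.whiskerRight_mem _ _ hf),
    fun h => h0 ?_⟩
  have h1 : (tensorRightHomEquiv X Y Y' Z).symm 0 = 0 := by simp [tensorRightHomEquiv]
  exact (tensorRightHomEquiv X Y Y' Z).symm.injective (h.trans h1.symm)

end TensorIdeal

/-! ### Endomorphisms of tensor powers in the oriented Brauer category. -/

namespace OB

variable {k : Type w} [Field k] {δ : k}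

/-- Any pair of bijections between the letters of each kind is a diagram without cups and caps,
hence invertible. So an object is determined up to isomorphism by its two letter counts. -/
theorem nonempty_iso {X Y : OB k δ} (h : Nat.card (Up X.word) = Nat.card (Up Y.word))
    (h' : Nat.card (Dn X.word) = Nat.card (Dn Y.word)) : Nonempty (X ≅ Y) :=
  ⟨permIso (Finite.card_eq.1 h).some (Finite.card_eq.1 h').some⟩

theorem card_up_tensor (X Y : OB k δ) :
    Nat.card (Up (X ⊗ Y).word) = Nat.card (Up X.word) + Nat.card (Up Y.word) :=
  Nat.card_sum

theorem card_dn_tensor (X Y : OB k δ) :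
    Nat.card (Dn (X ⊗ Y).word) = Nat.card (Dn X.word) + Nat.card (Dn Y.word) :=
  Nat.card_sum

/-- The points of the word `V^{⊗ n}`. -/
def powEquiv (k : Type w) [Field k] (δ : k) : (n : ℕ) → Fin n ≃ Up (tensorPow (V k δ) n).word
  | 0 => Equiv.equivEmpty (Fin 0)
  | n + 1 => (finSuccEquiv n).trans ((Equiv.optionEquivSumPUnit.{0} (Fin n)).trans
      ((Equiv.sumComm _ _).trans ((Equiv.refl Unit).sumCongr (powEquiv k δ n))))

theorem powEquiv_succ (n : ℕ) (i : Fin n) :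
    powEquiv k δ (n + 1) i.succ = Sum.inr (powEquiv k δ n i) := by
  change ((Equiv.refl Unit).sumCongr (powEquiv k δ n)) ((Equiv.sumComm _ _)
    ((Equiv.optionEquivSumPUnit.{0} (Fin n)) (finSuccEquiv n i.succ))) = _
  rw [finSuccEquiv_succ]
  rfl

instance isEmpty_dn_tensorPow : ∀ n : ℕ, IsEmpty (Dn (tensorPow (V k δ) n).word)
  | 0 => inferInstanceAs (IsEmpty Empty)
  | n + 1 =>
    have := isEmpty_dn_tensorPow n
    inferInstanceAs (IsEmpty (Empty ⊕ Dn (tensorPow (V k δ) n).word))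

theorem card_up_tensorPow (n : ℕ) : Nat.card (Up (tensorPow (V k δ) n).word) = n := by
  rw [← Nat.card_congr (powEquiv k δ n), Nat.card_fin]

theorem card_dn_tensorPow (n : ℕ) : Nat.card (Dn (tensorPow (V k δ) n).word) = 0 :=
  Nat.card_of_isEmpty

/-- The morphism given by a permutation of the upward points. -/
noncomputable def upHom (X : OB k δ) (e : Equiv.Perm (Up X.word)) : X ⟶ X :=
  OBHom.perm e (Equiv.refl _)

theorem upHom_one (X : OB k δ) : upHom X 1 = 𝟙 X := rfl

theorem upHom_comp (X : OB k δ) (e e' : Equiv.Perm (Up X.word)) :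
    upHom X e ≫ upHom X e' = upHom X (e' * e) :=
  OBHom.perm_comp_perm δ _ _ _ _

theorem whiskerLeft_upHom (X Y : OB k δ) (e : Equiv.Perm (Up Y.word)) :
    X ◁ upHom Y e = upHom (X ⊗ Y) (upCongr (Equiv.refl _) e) := by
  refine (OBHom.tensor_perm_perm _ _ _ _).trans ?_
  rw [dnCongr_refl]
  rfl

theorem sumCongr_refl_swap {S T : Type} {_ : DecidableEq T} {_ : DecidableEq (S ⊕ T)} (i j : T) :
    (Equiv.refl S).sumCongr (Equiv.swap i j) = Equiv.swap (Sum.inr i) (Sum.inr j) := by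
  ext (s | s)
  · rw [Equiv.swap_apply_of_ne_of_ne Sum.inl_ne_inr Sum.inl_ne_inr]
    rfl
  · rw [Sum.inr_injective.swap_apply]
    rfl

open Classical in
theorem swapHead_eq_upHom (T : OB k δ) : swapHead (V k δ) T =
    upHom (V k δ ⊗ V k δ ⊗ T) (Equiv.swap (Sum.inl ()) (Sum.inr (Sum.inl ()))) := by
  change OBHom.comp δ (OBHom.perm (upAssoc gen gen T.word).symm (dnAssoc gen gen T.word).symm)
    (OBHom.comp δ (OBHom.tensor (OBHom.perm (upComm gen gen) (dnComm gen gen))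
      (OBHom.perm (Equiv.refl _) (Equiv.refl _)))
      (OBHom.perm (upAssoc gen gen T.word) (dnAssoc gen gen T.word))) = OBHom.perm _ _
  rw [OBHom.tensor_perm_perm, OBHom.perm_comp_perm, OBHom.perm_comp_perm]
  congr 1
  · refine Equiv.ext fun s => ?_
    rcases s with ⟨⟩ | ⟨⟩ | s
    · exact (Equiv.swap_apply_left _ _).symm
    · exact (Equiv.swap_apply_right _ _).symm
    · symm
      apply Equiv.swap_apply_of_ne_of_ne
      · exact Sum.inr_ne_inl
      · exact fun h => Sum.inr_ne_inl (Sum.inr_injective h)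
  · refine Equiv.ext fun s => ?_
    rcases s with ⟨⟨⟩⟩ | ⟨⟨⟩⟩ | s
    rfl

open Classical in
theorem swapAdj_eq_upHom : ∀ (n : ℕ) (i : Fin n), swapAdj (V k δ) n i =
    upHom _ (Equiv.swap (powEquiv k δ (n + 1) i.castSucc) (powEquiv k δ (n + 1) i.succ))
  | n + 1, ⟨0, _⟩ => swapHead_eq_upHom _
  | n + 1, ⟨i + 1, hi⟩ => by
    have hi : i < n := by omega
    rw [swapAdj_succ, swapAdj_eq_upHom n ⟨i, hi⟩, whiskerLeft_upHom]
    have h1 : powEquiv k δ (n + 2) (Fin.castSucc ⟨i + 1, by omega⟩) =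
      Sum.inr (powEquiv k δ (n + 1) (Fin.castSucc ⟨i, hi⟩)) := powEquiv_succ (n + 1) (Fin.castSucc ⟨i, hi⟩)
    have h2 : powEquiv k δ (n + 2) (Fin.succ ⟨i + 1, by omega⟩) =
      Sum.inr (powEquiv k δ (n + 1) (Fin.succ ⟨i, hi⟩)) := powEquiv_succ (n + 1) (Fin.succ ⟨i, hi⟩)
    rw [h1, h2]
    exact congrArg _ (sumCongr_refl_swap _ _)

/-- Both sides are multiplicative with the same order of composition, so the transpositions of
neighbours, which generate the symmetric group, suffice. -/
theorem permHom_eq_upHom (n : ℕ) (g : Equiv.Perm (Fin n)) :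
    permHom (V k δ) n g = upHom _ ((powEquiv k δ n).permCongr g) := by
  rcases n with _ | n
  · rw [Subsingleton.elim g 1, permHom_one, ← upHom_one]
    congr 1
    exact Equiv.ext fun s => s.elim
  · have hg : g ∈ Submonoid.closure
        (Set.range fun i : Fin n => Equiv.swap i.castSucc i.succ) := by
      rw [Equiv.Perm.mclosure_swap_castSucc_succ]
      trivial
    induction hg using Submonoid.closure_induction with
    | mem x hx =>
      obtain ⟨i, rfl⟩ := hx
      classical
      refine (permAction_swap (V k δ) n i).trans ?_
      rw [swapAdj_eq_upHom]
      congr 1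
      exact (Equiv.symm_trans_swap_trans _ _ (powEquiv k δ (n + 1))).symm
    | one =>
      rw [permHom_one, ← upHom_one]
      congr 1
      exact (Equiv.ext fun s => by simp)
    | mul x y _ _ hx hy =>
      rw [permHom_mul, hx, hy, upHom_comp]
      congr 1
      exact (Equiv.ext fun s => by simp)

/-- `V^{⊗ n}` has no downward points, so a diagram from it to itself is a bijection of upward
points, that is, a permutation. -/
theorem braidingMorphism_surjective (n : ℕ) :
    Function.Surjective (braidingMorphism k (V k δ) n) := by
  intro f
  change OBHom k _ _ at f
  induction f using Finsupp.induction_linear with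
  | zero => exact ⟨0, map_zero _⟩
  | add f g hf hg =>
    obtain ⟨x, hx⟩ := hf
    obtain ⟨y, hy⟩ := hg
    exact ⟨x + y, (map_add _ _ _).trans (congrArg₂ (fun a b => a + b) hx hy)⟩
  | single d a =>
    let e : Equiv.Perm (Up (tensorPow (V k δ) n).word) :=
      (Equiv.sumEmpty _ _).symm.trans (d.trans (Equiv.sumEmpty _ _))
    refine ⟨MonoidAlgebra.single ((powEquiv k δ n).permCongr.symm e) a, ?_⟩
    rw [braidingMorphism_single, permHom_eq_upHom, Equiv.apply_symm_apply]
    refine (Finsupp.smul_single a _ (1 : k)).trans ?_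
    rw [smul_eq_mul, mul_one]
    congr 1
    refine Equiv.ext fun s => ?_
    rcases s with s | s
    · change Sum.inl ((Equiv.sumEmpty _ _) (d (Sum.inl s))) = d (Sum.inl s)
      rcases d (Sum.inl s) with t | t
      · rfl
      · exact isEmptyElim t
    · exact isEmptyElim s

/-- A non-zero morphism involves at least one diagram, and a diagram is a bijection between `m`
starting points and `n` end points. -/
theorem eq_of_tensorPow_hom_ne_zero {m n : ℕ} (f : tensorPow (V k δ) m ⟶ tensorPow (V k δ) n)
    (hf : f ≠ 0) : m = n := by
  change OBHom k _ _ at f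
  obtain ⟨d, -⟩ := Finsupp.ne_iff.1 hf
  have h := Nat.card_congr d
  rwa [Nat.card_sum, Nat.card_sum, card_up_tensorPow, card_up_tensorPow, card_dn_tensorPow,
    card_dn_tensorPow] at h

/-- The dual word as an object. -/
def dualObj (X : OB k δ) : OB k δ := ⟨X.word.dualWord⟩

theorem card_up_dualObj (X : OB k δ) : Nat.card (Up (dualObj X).word) = Nat.card (Dn X.word) :=
  Nat.card_congr (upDual _)

theorem card_dn_dualObj (X : OB k δ) : Nat.card (Dn (dualObj X).word) = Nat.card (Up X.word) :=
  Nat.card_congr (dnDual _)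

/-- Up to isomorphism a morphism goes from `V^{⊗ a} ⊗ (V^{⊗ b})*` to `V^{⊗ c} ⊗ (V^{⊗ d})*`. Duality
turns it into a morphism from `V^{⊗ (a + d)}` to `V^{⊗ (c + b)}`, and being non-zero forces `a + d =
c + b`. -/
theorem exists_ne_zero_tensorPow (I : TensorIdeal k (OB k δ)) (hI : I.IsNonzero) :
    ∃ n, ∃ f ∈ I.mor (tensorPow (V k δ) n) (tensorPow (V k δ) n), f ≠ 0 := by
  obtain ⟨X, Y, h⟩ := hI
  let dualPairing (X : OB k δ) : ExactPairing X (dualObj X) := exactPairing X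
  -- The tensor powers are made opaque: only their letter counts `hU` and `hD` matter until the end.
  obtain ⟨P, hP⟩ : ∃ P, P = tensorPow (V k δ) := ⟨_, rfl⟩
  have hU : ∀ n, Nat.card (Up (P n).word) = n := fun n => hP ▸ card_up_tensorPow n
  have hD : ∀ n, Nat.card (Dn (P n).word) = 0 := fun n => hP ▸ card_dn_tensorPow n
  have e : ∀ X : OB k δ, Nonempty (X ≅ P (Nat.card (Up X.word)) ⊗
      dualObj (P (Nat.card (Dn X.word)))) := fun X => nonempty_iso
    (by simp only [card_up_tensor, card_up_dualObj, hU, hD, add_zero])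
    (by simp only [card_dn_tensor, card_dn_dualObj, hU, hD, zero_add])
  obtain ⟨eX⟩ := e X
  obtain ⟨eY⟩ := e Y
  -- The dual letters of the source move to the target as a double dual, which has the letter counts
  -- of `P b` itself.
  have h1 := I.exists_ne_zero_of_tensorRight _ _ (dualObj (dualObj (P (Nat.card (Dn X.word))))) _
    (I.exists_ne_zero_of_iso eX eY h)
  generalize Nat.card (Up X.word) = a at h1
  generalize Nat.card (Dn X.word) = b at h1
  generalize Nat.card (Up Y.word) = c at h1
  generalize Nat.card (Dn Y.word) = d at h1
  obtain ⟨e1⟩ : Nonempty ((P c ⊗ dualObj (P d)) ⊗ dualObj (dualObj (P b)) ≅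
      P (c + b) ⊗ dualObj (P d)) := nonempty_iso
    (by simp only [card_up_tensor, card_up_dualObj, card_dn_dualObj, hU, hD, add_zero])
    (by simp only [card_dn_tensor, card_dn_dualObj, card_up_dualObj, hU, hD, add_zero])
  -- The dual letters of the target move to the source, leaving only copies of `V` on both sides.
  have h2 := I.exists_ne_zero_of_tensorRight_symm (P a) (P d) (dualObj (P d)) (P (c + b))
    (I.exists_ne_zero_of_iso (Iso.refl (P a)) e1 h1)
  obtain ⟨e2⟩ : Nonempty (P a ⊗ P d ≅ P (a + d)) := nonempty_iso
    (by simp only [card_up_tensor, hU]) (by simp only [card_dn_tensor, hD, add_zero])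
  obtain ⟨f, hf, h0⟩ := I.exists_ne_zero_of_iso e2 (Iso.refl _) h2
  subst hP
  have h3 := eq_of_tensorPow_hom_ne_zero f h0
  generalize a + d = n at f hf h0 h3
  subst h3
  exact ⟨_, f, hf, h0⟩

/-- Otherwise a non-zero ideal would contain the action of some `x ≠ 0` on a power of `V`, hence the
identity of the unit object, and so would not be proper. -/
theorem mem_range_of_tensorIdeal (p : ℕ) [Fact p.Prime] [CharP k p] (I : TensorIdeal k (OB k δ))
    (h : I.IsNonzero) (h' : I.IsProper) : δ ∈ (ZMod.castHom (dvd_refl p) k).range := by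
  by_contra hδ
  obtain ⟨n, f, hf, h0⟩ := exists_ne_zero_tensorPow I h
  obtain ⟨x, rfl⟩ := braidingMorphism_surjective n f
  obtain ⟨X, Y, g, hg⟩ := h'
  refine hg (I.mem_of_id_unit_mem (I.id_unit_mem k p (V k δ) ?_ n x ?_ hf) g)
  · rwa [categoricalDim_V]
  · rintro rfl
    exact h0 (map_zero _)

end OB

theorem mainTheorem12 :
    (∀ (k : Type w) [Field k] (A : Type u) [Category.{v} A] [Preadditive A] [Linear k A]
      [MonoidalCategory A] [SymmetricCategory A] [MonoidalPreadditive A] [MonoidalLinear k A]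
      [RigidCategory A] [IsRSMCategory k A] (X : A),
      (∃ n : ℕ, braidingMorphism k X n (skewSymmetriser k n) = 0) →
      ∃ m : ℕ, IsGreatest {n : ℕ | braidingMorphism k X n (skewSymmetriser k n) ≠ 0} m ∧
        categoricalDim k X = (m : k)) ∧
    (∀ (k : Type w) [Field k] (p : ℕ) [Fact p.Prime] [CharP k p] (δ : k),
      (∃ I : TensorIdeal k (OB k δ), I.IsNonzero ∧ I.IsProper) →
      δ ∈ (ZMod.castHom (dvd_refl p) k).range) :=
  ⟨fun k _ _ _ _ _ _ _ _ _ _ _ X h => exists_isGreatest_skewSymmetriser k X h,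
    fun _ _ p _ _ _ ⟨I, h, h'⟩ => OB.mem_range_of_tensorIdeal p I h h'⟩
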